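/- Let $0<r_i<r_e$. For $0<\epsilon<r_e-r_i$ let $B_i=B_i^\epsilon$ and $B_e=B_e^\epsilon$ be the open disks in $\mathbb{R}^2$ with radii $r_i$, $r_e$ and centers $(c_i,0)$, $(c_e,0)$, where $$c_i=\frac{r_e^2-r_i^2-(r_e-r_i-\epsilon)^2}{2(r_e-r_i-\epsilon)},\qquad c_e=c_i+r_e-r_i-\epsilon,$$ so that $B_i\subset B_e$ and $\mathrm{dist}(\partial B_i,\partial B_e)=\epsilon$. For $k_i,k_e\in(0,\infty)$ let $\sigma=k_i\chi(B_i)+k_e\chi(B_e\setminus B_i)+\chi(\mathbb{R}^2\setminus B_e)$. For an entire harmonic function $F:\mathbb{R}^2\to\mathbb{R}$, a solution of the core-shell conductivity problem with background field $F$ is a continuous function $u\in H^1_{loc}(\mathbb{R}^2)$ with $$\nabla\cdot\sigma\nabla u=0\ \text{ in }\mathbb{R}^2\ \text{ (weakly)},\qquad u(\mathbf{x})-F(\mathbf{x})=O(|\mathbf{x}|^{-1})\ \text{ as }|\mathbf{x}|\to\infty .$$ Let $H$ be an arbitrary entire harmonic function, and put $H_1(\mathbf{x})=\nabla H(\mathbf{0})\cdot\mathbf{x}$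 and $H_2=H-H_1$. Then for every $\epsilon_0<r_e-r_i$ there is a constant $C$, depending only on $r_i$, $r_e$, $\epsilon_0$ and $H$ (not on $\epsilon$, $k_i$, $k_e$), such that for all $0<\epsilon\le\epsilon_0$ and all $k_i,k_e>0$ the following holds. The problems with background fields $H$, $H_1$ and $H_2$ have unique solutions $u$, $u_1$ and $u_2$, respectively, and $$u=u_1+u_2\ \text{ in }\mathbb{R}^2,\qquad \|\nabla(u_2-H_2)\|_{L^\infty(\mathbb{R}^2)}<C .$$ -/

import Mathlib

open Set Filter Topology MeasureTheory Asymptotics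
open scoped ContDiff

/- Throughout, the plane is identified with `ℂ` via `(x, y) ↦ x + i y`. As a real inner product
space `ℂ` carries the Euclidean dot product and norm, and `volume` is the Lebesgue measure. -/

namespace CoreShell

/-- First coordinate of the centre of the core `B_i`, a disk of radius `ri`, when `ε` is the
distance between the boundary circles. -/
noncomputable def coreCenter (ri re ε : ℝ) : ℝ :=
  (re ^ 2 - ri ^ 2 - (re - ri - ε) ^ 2) / (2 * (re - ri - ε))

/-- First coordinate of the centre of the outer disk `B_e`, which has radius `re`. -/
noncomputable def shellCenter (ri re ε : ℝ) : ℝ :=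
  coreCenter ri re ε + re - ri - ε

/-- The core `B_i`. -/
noncomputable def core (ri re ε : ℝ) : Set ℂ :=
  Metric.ball (coreCenter ri re ε : ℂ) ri

/-- The outer disk `B_e`; the shell is `B_e \ B_i`. -/
noncomputable def outerDisk (ri re ε : ℝ) : Set ℂ :=
  Metric.ball (shellCenter ri re ε : ℂ) re

/-- The conductivity `σ = k_i χ(B_i) + k_e χ(B_e \ B_i) + χ(ℝ² \ B_e)`. -/
noncomputable def conductivity (ri re ε ki ke : ℝ) (x : ℂ) : ℝ :=
  (core ri re ε).indicator (fun _ => ki) x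
    + (outerDisk ri re ε \ core ri re ε).indicator (fun _ => ke) x
    + (outerDisk ri re ε)ᶜ.indicator (fun _ => 1) x

/-- `G` is the weak (distributional) gradient of `f` on the plane. -/
structure HasWeakGradient (f : ℂ → ℝ) (G : ℂ → ℂ) : Prop where
  locallyIntegrable : LocallyIntegrable f volume
  locallyIntegrable_grad : LocallyIntegrable G volume
  integral_eq : ∀ φ : ℂ → ℝ, ContDiff ℝ ∞ φ → HasCompactSupport φ →
    ∫ x, f x • gradient φ x = - ∫ x, φ x • G x

/-- `∇ · σ ∇ u = 0` in the plane, in the weak sense: `u` is in `H¹_loc` (it has a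
weak gradient in `L²_loc`, so in the plane `u` itself is automatically in `L²_loc`) and `∫ σ ∇u · ∇φ = 0` for all test
functions `φ`. -/
def IsWeakSolution (σ u : ℂ → ℝ) : Prop :=
  ∃ G : ℂ → ℂ, HasWeakGradient u G ∧
    (∀ K : Set ℂ, IsCompact K → MemLp G 2 (volume.restrict K)) ∧
    ∀ φ : ℂ → ℝ, ContDiff ℝ ∞ φ → HasCompactSupport φ →
      ∫ x, σ x * inner ℝ (G x) (gradient φ x) = 0

/-- `u` solves the conductivity problem with conductivity `σ` and background potential `H`:
`∇ · σ ∇ u = 0` in the plane and `u - H = O(|x|⁻¹)` as `|x| → ∞`. The continuous representative of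
the weak solution is taken, so that `u` is determined at every point. -/
structure IsSolution (σ H u : ℂ → ℝ) : Prop where
  continuous : Continuous u
  weak : IsWeakSolution σ u
  decay : (fun x => u x - H x) =O[Bornology.cobounded ℂ] (fun x => ‖x‖⁻¹)

/-- The linear part `H₁(x) = ∇H(0) · x`. -/
noncomputable def linearPart (H : ℂ → ℝ) (x : ℂ) : ℝ :=
  inner ℝ (gradient H 0) x

/-- The remainder `H₂ = H - H₁`. -/
noncomputable def nonlinearPart (H : ℂ → ℝ) (x : ℂ) : ℝ :=
  H x - linearPart H x

end CoreShell

/-!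
The plane is `ℂ`, and `H = Re f` with `f` entire.

*Uniqueness.* The difference `w` of two solutions is a weak solution that is `O(|x|⁻¹)`. Testing the
equation with `χ² w` for cut-off functions `χ` gives Caccioppoli's inequality (`caccioppoli`), so the
energy of `w` in a fixed disk is bounded by that of `χ` times `sup |w|²` far out, which tends to
zero. Since the test functions have to be smooth, `w` is mollified first; the mollified gradients
converge weakly in `L²_loc` because translations act continuously on `L²`
(`tendsto_integral_inner_mollify`).

*Existence.* The two circles have the imaginary axis as radical axis, so the composition `T` of the
inversions `R_i`, `R_e` in them is a hyperbolic Möbius map of the right half-plane with fixed points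
`±√a`, where `a` is the common power of the origin. With the reflection coefficients
`λ_i = (k_i - k_e) / (k_i + k_e)` and `λ_e = (k_e - 1) / (k_e + 1)`, the method of images leads to
`S = ∑ (-λ_e λ_i)^k f ∘ T^k`, a solution of `S = f - λ_e λ_i S ∘ T`, and to the solution that is, up
to a constant, `(1 - λ_i) (1 - λ_e) Re S` in the core, `(1 - λ_e) Re (S - λ_i S ∘ R_i)` in the shell
and `Re (f - λ_e S ∘ R_e - λ_i S ∘ T ∘ R_e)` outside. Instead of matching fluxes along the circles,
the transmission condition is checked through a stream function: the same formulas with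
`(-λ_i, -λ_e, -i f)` in place of `(λ_i, λ_e, f)` give a continuous, locally Lipschitz function whose
gradient is `σ ∇u` rotated by a right angle (`IsCoreShell.gradient_potential_neg`), and rotated
gradients are divergence-free. Inversions are `1`-Lipschitz outside their circles, so bounds for the
derivatives of `S` and `S ∘ T` on the outer disk bound `∇(u - H)` everywhere
(`IsCoreShell.lipschitzWith_potential_sub`).

*The bound.* If `∇H(0) = 0`, then `|f' z| ≤ M |z|` on bounded sets, and
`|S'| ≤ M ∑ |T^k z| |(T^k)' z|` whatever the reflection coefficients are. The sum is bounded on the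
outer disk uniformly in the distance of the circles (`sum_norm_mob_mul_norm_deriv_le`), although
without the factor `|T^k z|` it blows up as they touch. The solution for `H₁` is the difference of
those for `H` and `H₂`.
-/

namespace CoreShell

open Complex ComplexConjugate
open scoped NNReal Convolution

/-! ### Locally Lipschitz functions and weak gradients -/

theorem lipschitzOnWith_of_closed_cover {f : ℂ → ℝ} {K : ℝ≥0} {s A B : Set ℂ} (hs : Convex ℝ s)
    (hA : IsClosed A) (hB : IsClosed B) (hcov : s ⊆ A ∪ B)
    (hfA : LipschitzOnWith K f (s ∩ A)) (hfB : LipschitzOnWith K f (s ∩ B)) :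
    LipschitzOnWith K f s := by
  have key : ∀ x ∈ s ∩ A, ∀ y ∈ s ∩ B, dist (f x) (f y) ≤ K * dist x y := by
    intro x hx y hy
    obtain ⟨p, hps, hpA, hpB⟩ := isPreconnected_closed_iff.1
      (convex_segment x y).isPreconnected A B hA hB
      ((hs.segment_subset hx.1 hy.1).trans hcov)
      ⟨x, left_mem_segment ℝ x y, hx.2⟩ ⟨y, right_mem_segment ℝ x y, hy.2⟩
    have hp := hs.segment_subset hx.1 hy.1 hps
    have h1 := hfA.dist_le_mul x hx p ⟨hp, hpA⟩
    have h2 := hfB.dist_le_mul p ⟨hp, hpB⟩ y hy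
    have h3 := dist_add_dist_of_mem_segment hps
    calc dist (f x) (f y) ≤ dist (f x) (f p) + dist (f p) (f y) := dist_triangle _ _ _
      _ ≤ K * dist x p + K * dist p y := add_le_add h1 h2
      _ = K * dist x y := by rw [← mul_add, h3]
  refine LipschitzOnWith.of_dist_le_mul fun x hx y hy => ?_
  rcases hcov hx with hxA | hxB <;> rcases hcov hy with hyA | hyB
  · exact hfA.dist_le_mul x ⟨hx, hxA⟩ y ⟨hy, hyA⟩
  · exact key x ⟨hx, hxA⟩ y ⟨hy, hyB⟩
  · rw [dist_comm (f x), dist_comm x]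
    exact key y ⟨hy, hyA⟩ x ⟨hx, hxB⟩
  · exact hfB.dist_le_mul x ⟨hx, hxB⟩ y ⟨hy, hyB⟩

/-- Lipschitz on every disk centred at the origin. -/
def LipschitzOnDisks (f : ℂ → ℝ) : Prop :=
  ∀ R : ℝ, ∃ K : ℝ≥0, LipschitzOnWith K f (Metric.ball 0 R)

theorem _root_.LipschitzWith.lipschitzOnDisks {f : ℂ → ℝ} {K : ℝ≥0} (hf : LipschitzWith K f) :
    LipschitzOnDisks f :=
  fun _ => ⟨K, hf.lipschitzOnWith⟩

theorem LipschitzOnDisks.add {f g : ℂ → ℝ} (hf : LipschitzOnDisks f) (hg : LipschitzOnDisks g) :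
    LipschitzOnDisks (fun x => f x + g x) := fun R => by
  obtain ⟨K, hK⟩ := hf R
  obtain ⟨L, hL⟩ := hg R
  exact ⟨K + L, hK.add hL⟩

theorem mem_ball_zero_nhds (x : ℂ) : Metric.ball (0 : ℂ) (‖x‖ + 1) ∈ 𝓝 x :=
  Metric.isOpen_ball.mem_nhds (by simp)

theorem LipschitzOnDisks.continuous {f : ℂ → ℝ} (hf : LipschitzOnDisks f) : Continuous f := by
  refine continuous_iff_continuousAt.2 fun x => ?_
  obtain ⟨K, hK⟩ := hf (‖x‖ + 1)
  exact hK.continuousOn.continuousAt (mem_ball_zero_nhds x)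

/-- Entire functions have locally Lipschitz real parts. -/
theorem lipschitzOnDisks_re {f : ℂ → ℂ} (hf : Differentiable ℂ f) :
    LipschitzOnDisks fun z => (f z).re := fun R => by
  have hcont : Continuous (deriv f) := (hf.contDiff (n := 1)).continuous_deriv le_rfl
  obtain ⟨C, hC⟩ := (isCompact_closedBall (0 : ℂ) R).exists_bound_of_continuousOn
    hcont.continuousOn
  refine ⟨C.toNNReal, ?_⟩
  have h1 : LipschitzOnWith C.toNNReal f (Metric.ball 0 R) := by
    refine Convex.lipschitzOnWith_of_nnnorm_deriv_le (fun x _ => hf x) (fun x hx => ?_)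
      (convex_ball _ _)
    rw [← NNReal.coe_le_coe, coe_nnnorm]
    exact (hC x (Metric.ball_subset_closedBall hx)).trans (Real.le_coe_toNNReal C)
  refine LipschitzOnWith.of_dist_le_mul fun x hx y hy => le_trans ?_ (h1.dist_le_mul x hx y hy)
  rw [Real.dist_eq, dist_eq_norm, ← sub_re]
  exact abs_re_le_norm _

theorem norm_gradient (f : ℂ → ℝ) (x : ℂ) : ‖gradient f x‖ = ‖fderiv ℝ f x‖ := by
  simp [gradient]

theorem measurable_gradient (f : ℂ → ℝ) : Measurable (gradient f) :=
  (InnerProductSpace.toDual ℝ ℂ).symm.continuous.measurable.comp (measurable_fderiv ℝ f)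

theorem norm_gradient_le {f : ℂ → ℝ} {K : ℝ≥0} {s : Set ℂ} {x : ℂ}
    (hf : LipschitzOnWith K f s) (hs : s ∈ 𝓝 x) : ‖gradient f x‖ ≤ K := by
  rw [norm_gradient]
  exact norm_fderiv_le_of_lipschitzOn ℝ hs hf

theorem LipschitzOnDisks.exists_norm_gradient_le {f : ℂ → ℝ} (hf : LipschitzOnDisks f)
    {s : Set ℂ} (hs : Bornology.IsBounded s) : ∃ K : ℝ≥0, ∀ x ∈ s, ‖gradient f x‖ ≤ K := by
  obtain ⟨R, hR⟩ := hs.subset_ball 0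
  obtain ⟨K, hK⟩ := hf R
  exact ⟨K, fun x hx => norm_gradient_le hK (Metric.isOpen_ball.mem_nhds (hR hx))⟩

theorem LipschitzOnDisks.memLp_gradient {f : ℂ → ℝ} (hf : LipschitzOnDisks f) {s : Set ℂ}
    (hs : IsCompact s) (p : ENNReal) : MemLp (gradient f) p (volume.restrict s) := by
  obtain ⟨K, hK⟩ := hf.exists_norm_gradient_le hs.isBounded
  have : IsFiniteMeasure (volume.restrict s) := ⟨by simpa using hs.measure_lt_top⟩
  exact MemLp.of_bound (measurable_gradient f).aestronglyMeasurable K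
    ((ae_restrict_iff' hs.measurableSet).2 (Eventually.of_forall hK))

theorem locallyIntegrable_of_memLp {E : Type*} [NormedAddCommGroup E] {G : ℂ → E}
    (h : ∀ K : Set ℂ, IsCompact K → MemLp G 2 (volume.restrict K)) :
    LocallyIntegrable G volume := by
  refine locallyIntegrable_iff.2 fun K hK => ?_
  have : IsFiniteMeasure (volume.restrict K) := ⟨by simpa using hK.measure_lt_top⟩
  exact (h K hK).integrable one_le_two

theorem re_gradient (f : ℂ → ℝ) (x : ℂ) : (gradient f x).re = fderiv ℝ f x 1 := by
  have := inner_gradient_left (𝕜 := ℝ) (f := f) (x := x) (y := (1 : ℂ))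
  rw [← this, Complex.inner]
  simp

theorem im_gradient (f : ℂ → ℝ) (x : ℂ) : (gradient f x).im = fderiv ℝ f x I := by
  have := inner_gradient_left (𝕜 := ℝ) (f := f) (x := x) (y := I)
  rw [← this, Complex.inner]
  simp

theorem continuous_gradient {φ : ℂ → ℝ} (hφ : ContDiff ℝ ∞ φ) : Continuous (gradient φ) :=
  (InnerProductSpace.toDual ℝ ℂ).symm.continuous.comp
    (hφ.continuous_fderiv (by simp))

theorem hasCompactSupport_gradient {φ : ℂ → ℝ} (hφ : HasCompactSupport φ) :
    HasCompactSupport (gradient φ) :=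
  (hφ.fderiv (𝕜 := ℝ)).comp_left (g := (InnerProductSpace.toDual ℝ ℂ).symm) (by simp)

/-- The weak gradient of a locally Lipschitz function is its almost everywhere defined classical
gradient. -/
theorem LipschitzOnDisks.hasWeakGradient {f : ℂ → ℝ} (hf : LipschitzOnDisks f) :
    HasWeakGradient f (gradient f) where
  locallyIntegrable := hf.continuous.locallyIntegrable
  locallyIntegrable_grad := locallyIntegrable_of_memLp fun K hK => hf.memLp_gradient hK 2
  integral_eq φ hφ hφc := by
    obtain ⟨R, hR⟩ := hφc.isCompact.isBounded.subset_ball 0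
    obtain ⟨K, hK⟩ := hf R
    obtain ⟨g, hg, hfg⟩ := hK.extend_real
    obtain ⟨D, hD⟩ := (hφ.of_le (m := 1) (by simp)).lipschitzWith_of_hasCompactSupport hφc
      (by simp)
    have hint1 : Integrable (fun x => f x • gradient φ x) := by
      refine (hf.continuous.smul (continuous_gradient hφ)).integrable_of_hasCompactSupport ?_
      exact (hasCompactSupport_gradient hφc).smul_left
    have hint2 : Integrable (fun x => φ x • gradient f x) :=
      (locallyIntegrable_of_memLp fun K hK => hf.memLp_gradient hK
        2).integrable_smul_left_of_hasCompactSupport hφ.continuous hφc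
    have key : ∀ v : ℂ, ∫ x, f x * fderiv ℝ φ x v = - ∫ x, φ x * fderiv ℝ f x v := by
      intro v
      have h := LipschitzWith.integral_lineDeriv_mul_eq (μ := volume) hg hD hφc v
      have e1 : ∫ x, lineDeriv ℝ g x v * φ x = ∫ x, φ x * fderiv ℝ f x v := by
        refine integral_congr_ae ?_
        filter_upwards [hg.ae_differentiableAt] with x hx
        rw [hx.lineDeriv_eq_fderiv]
        by_cases hxs : x ∈ tsupport φ
        · have : f =ᶠ[𝓝 x] g :=
            Filter.eventuallyEq_of_mem (Metric.isOpen_ball.mem_nhds (hR hxs)) hfg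
          rw [this.fderiv_eq, mul_comm]
        · simp [image_eq_zero_of_notMem_tsupport hxs]
      have e2 : ∫ x, lineDeriv ℝ φ x (-v) * g x = - ∫ x, f x * fderiv ℝ φ x v := by
        rw [← integral_neg]
        refine integral_congr_ae (Eventually.of_forall fun x => ?_)
        have hd : DifferentiableAt ℝ φ x := (hφ.differentiable (by simp)) x
        simp only [hd.lineDeriv_eq_fderiv, map_neg]
        by_cases hxs : x ∈ tsupport φ
        · rw [hfg (hR hxs)]; ring
        · have : fderiv ℝ φ x = 0 :=
            image_eq_zero_of_notMem_tsupport (fun h => hxs (tsupport_fderiv_subset ℝ h))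
          simp [this]
      rw [e1, e2] at h
      rw [h, neg_neg]
    have cast : ∀ {F : ℂ → ℂ}, Integrable F → (∫ x, F x).re = ∫ x, (F x).re ∧
        (∫ x, F x).im = ∫ x, (F x).im := fun hF =>
      ⟨(integral_re hF).symm, (integral_im hF).symm⟩
    apply Complex.ext
    · rw [neg_re, (cast hint1).1, (cast hint2).1]
      simpa [re_gradient] using key 1
    · rw [neg_im, (cast hint1).2, (cast hint2).2]
      simpa [im_gradient] using key I

/-- Rotating a weak gradient by a right angle gives a divergence-free field. -/
theorem HasWeakGradient.integral_inner_I_mul {v : ℂ → ℝ} {G : ℂ → ℂ} (h : HasWeakGradient v G)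
    {φ : ℂ → ℝ} (hφ : ContDiff ℝ ∞ φ) (hφc : HasCompactSupport φ) :
    ∫ x, inner ℝ (G x) (I * gradient φ x) = 0 := by
  have hd : ∀ e : ℂ, ContDiff ℝ ∞ (fun x => fderiv ℝ φ x e) := fun e =>
    (hφ.fderiv_right (m := ∞) (by simp)).clm_apply contDiff_const
  have hc : ∀ e : ℂ, HasCompactSupport (fun x => fderiv ℝ φ x e) := fun e =>
    (hφc.fderiv (𝕜 := ℝ)).comp_left (g := fun L : ℂ →L[ℝ] ℝ => L e) (by simp)
  have hi1 : ∀ e, Integrable (fun x => v x • gradient (fun x => fderiv ℝ φ x e) x) := fun e =>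
    h.locallyIntegrable.integrable_smul_right_of_hasCompactSupport
      (continuous_gradient (hd e)) (hasCompactSupport_gradient (hc e))
  have hi2 : ∀ e, Integrable (fun x => fderiv ℝ φ x e • G x) := fun e =>
    h.locallyIntegrable_grad.integrable_smul_left_of_hasCompactSupport (hd e).continuous (hc e)
  have e1 := congrArg Complex.re (h.integral_eq _ (hd I) (hc I))
  have e2 := congrArg Complex.im (h.integral_eq _ (hd 1) (hc 1))
  have cre : ∀ {F : ℂ → ℂ}, Integrable F → (∫ x, F x).re = ∫ x, (F x).re := fun hF =>
    (integral_re hF).symm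
  have cim : ∀ {F : ℂ → ℂ}, Integrable F → (∫ x, F x).im = ∫ x, (F x).im := fun hF =>
    (integral_im hF).symm
  rw [neg_re, cre (hi1 I), cre (hi2 I)] at e1
  rw [neg_im, cim (hi1 1), cim (hi2 1)] at e2
  have hsymm : ∀ x, fderiv ℝ (fun x => fderiv ℝ φ x I) x 1
      = fderiv ℝ (fun x => fderiv ℝ φ x 1) x I := by
    intro x
    have hdd : DifferentiableAt ℝ (fderiv ℝ φ) x :=
      ((hφ.fderiv_right (m := ∞) (by simp)).differentiable (by simp)) x
    rw [fderiv_clm_apply hdd (by fun_prop), fderiv_clm_apply hdd (by fun_prop)]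
    have := (hφ.contDiffAt (x := x)).isSymmSndFDerivAt
      (by simp; exact WithTop.coe_le_coe.2 le_top)
    simpa using this 1 I
  have : ∫ x, (v x • gradient (fun x => fderiv ℝ φ x I) x).re
      = ∫ x, (v x • gradient (fun x => fderiv ℝ φ x 1) x).im := by
    refine integral_congr_ae (Eventually.of_forall fun x => ?_)
    simp only [smul_re, smul_im, re_gradient, im_gradient, hsymm]
  rw [this, e2] at e1
  have e3 : ∀ x, inner ℝ (G x) (I * gradient φ x)
      = (fderiv ℝ φ x 1 • G x).im - (fderiv ℝ φ x I • G x).re := by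
    intro x
    rw [Complex.inner]
    simp [re_gradient, im_gradient]
    ring
  simp_rw [e3]
  refine (integral_sub (hi2 1).im (hi2 I).re).trans (sub_eq_zero.2 ?_)
  exact neg_injective e1

/-! ### Mollification -/

/-- A weak gradient is turned into a classical one by convolution with a test function. -/
theorem gradient_convolution {W : ℂ → ℝ} {G : ℂ → ℂ} (h : HasWeakGradient W G) {ρ : ℂ → ℝ}
    (hρ : ContDiff ℝ ∞ ρ) (hρc : HasCompactSupport ρ) (x : ℂ) :
    gradient (ρ ⋆[ContinuousLinearMap.lsmul ℝ ℝ, volume] W) x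
      = (ρ ⋆[ContinuousLinearMap.lsmul ℝ ℝ, volume] G) x := by
  have hd := hρc.hasFDerivAt_convolution_left (μ := volume) (ContinuousLinearMap.lsmul ℝ ℝ)
    (hρ.of_le (by simp)) h.locallyIntegrable x
  have hint : Integrable fun t => (ContinuousLinearMap.precompL ℂ
      (ContinuousLinearMap.lsmul ℝ ℝ : ℝ →L[ℝ] ℝ →L[ℝ] ℝ)) (fderiv ℝ ρ t) (W (x - t)) :=
    (hρc.fderiv (𝕜 := ℝ)).convolutionExists_left (ContinuousLinearMap.precompL ℂ
      (ContinuousLinearMap.lsmul ℝ ℝ : ℝ →L[ℝ] ℝ →L[ℝ] ℝ))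
      (hρ.continuous_fderiv (by simp)) h.locallyIntegrable x
  have hρd : Differentiable ℝ ρ := hρ.differentiable (by simp)
  have e1 : gradient (ρ ⋆[ContinuousLinearMap.lsmul ℝ ℝ, volume] W) x
      = ∫ t, W (x - t) • gradient ρ t := by
    rw [gradient, hd.fderiv, convolution_def,
      ← LinearIsometryEquiv.coe_toContinuousLinearEquiv,
      ← ContinuousLinearEquiv.integral_comp_comm]
    refine integral_congr_ae (Eventually.of_forall fun t => ?_)
    simp only [LinearIsometryEquiv.coe_toContinuousLinearEquiv]
    rw [gradient, ← map_smul]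
    congr 1
    ext v
    simp [ContinuousLinearMap.precompL_apply, mul_comm]
  have hφ : ContDiff ℝ ∞ fun t => ρ (x - t) := hρ.comp (contDiff_const.sub contDiff_id)
  have hφc : HasCompactSupport fun t => ρ (x - t) :=
    hρc.comp_homeomorph (Homeomorph.subLeft x)
  have e2 := h.integral_eq _ hφ hφc
  have e3 : ∀ t, gradient (fun t => ρ (x - t)) t = - gradient ρ (x - t) := by
    intro t
    have : HasFDerivAt (fun t => ρ (x - t)) (-(fderiv ℝ ρ (x - t))) t := by
      have := (hρd (x - t)).hasFDerivAt.comp t ((hasFDerivAt_id (𝕜 := ℝ) t).const_sub x)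
      have heq : (fderiv ℝ ρ (x - t)).comp (-ContinuousLinearMap.id ℝ ℂ)
          = -(fderiv ℝ ρ (x - t)) := by
        ext v
        simp
      rw [heq] at this
      exact this
    rw [gradient, this.fderiv, map_neg, gradient]
  simp_rw [e3, smul_neg] at e2
  rw [integral_neg, neg_inj] at e2
  rw [e1, convolution_def, ← integral_sub_left_eq_self _ volume x]
  simp only [sub_sub_cancel]
  rw [e2, ← integral_sub_left_eq_self _ volume x]
  simp

/-- The correlation of two square-integrable fields is continuous, since translations act
continuously on `L²`. -/
theorem continuous_integral_inner_add {ψ F : ℂ → ℂ} (hψ : MemLp ψ 2 volume)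
    (hF : MemLp F 2 volume) : Continuous fun h : ℂ => ∫ x, inner ℝ (ψ x) (F (x + h)) := by
  have hmk : Continuous (DomAddAct.mk : ℂ → ℂᵈᵃᵃ) := DomAddAct.continuous_mk
  have : Fact ((2 : ENNReal) ≠ ⊤) := ⟨by simp⟩
  have hc : Continuous fun h : ℂ => inner ℝ (hψ.toLp ψ) (DomAddAct.mk h +ᵥ hF.toLp F) :=
    continuous_const.inner (hmk.vadd continuous_const)
  convert hc using 2 with h
  rw [DomAddAct.mk_vadd_toLp, L2.inner_def]
  refine integral_congr_ae ?_
  filter_upwards [hψ.coeFn_toLp, MemLp.coeFn_toLp (hF.comp_measurePreserving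
    (measurePreserving_vadd h volume))] with x h1 h2
  rw [h1]
  erw [h2]
  simp [add_comm]

theorem integral_inner_convolution {ψ F : ℂ → ℂ} (hψ : MemLp ψ 2 volume)
    (hF : MemLp F 2 volume) {ρ : ℂ → ℝ} (hρ : Continuous ρ) (hρc : HasCompactSupport ρ) :
    ∫ x, inner ℝ (ψ x) ((ρ ⋆[ContinuousLinearMap.lsmul ℝ ℝ, volume] F) x)
      = (ρ ⋆[ContinuousLinearMap.lsmul ℝ ℝ, volume]
          fun h : ℂ => ∫ x, inner ℝ (ψ x) (F (x + h))) 0 := by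
  have hρi : Integrable ρ := hρ.integrable_of_hasCompactSupport hρc
  have hρn : Integrable fun t => ‖ρ t‖ := hρi.norm
  have hψ2 : Integrable fun x => ‖ψ x‖ ^ 2 := hψ.integrable_norm_pow two_ne_zero
  have hF2 : Integrable fun x => ‖F x‖ ^ 2 := hF.integrable_norm_pow two_ne_zero
  have hFl : LocallyIntegrable F := hF.locallyIntegrable one_le_two
  have hm : AEStronglyMeasurable (fun p : ℂ × ℂ => inner ℝ (ψ p.1) (ρ p.2 • F (p.1 - p.2)))
      (volume.prod volume) := by
    refine (hψ.1.comp_fst (ν := volume)).inner ?_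
    exact hρ.aestronglyMeasurable.convolution_integrand (ContinuousLinearMap.lsmul ℝ ℝ) hF.1
  have hint : Integrable (fun p : ℂ × ℂ => inner ℝ (ψ p.1) (ρ p.2 • F (p.1 - p.2)))
      (volume.prod volume) := by
    have i1 : Integrable (fun p : ℂ × ℂ => ‖ψ p.1‖ ^ 2 * ‖ρ p.2‖) (volume.prod volume) :=
      hψ2.mul_prod hρn
    have i2 : Integrable (fun p : ℂ × ℂ => ‖ρ p.2‖ * ‖F (p.1 - p.2)‖ ^ 2)
        (volume.prod volume) :=
      Integrable.convolution_integrand (ContinuousLinearMap.mul ℝ ℝ) hρn hF2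
    refine (i1.add i2).mono' hm (Eventually.of_forall fun p => ?_)
    refine (norm_inner_le_norm _ _).trans ?_
    rw [norm_smul]
    simp only [Pi.add_apply]
    nlinarith [mul_nonneg (norm_nonneg (ρ p.2)) (sq_nonneg (‖ψ p.1‖ - ‖F (p.1 - p.2)‖)),
      mul_nonneg (norm_nonneg (ρ p.2)) (add_nonneg (sq_nonneg ‖ψ p.1‖)
        (sq_nonneg ‖F (p.1 - p.2)‖))]
  have hswap := integral_integral_swap
    (f := fun x t => inner ℝ (ψ x) (ρ t • F (x - t))) hint
  simp only [convolution_def, ContinuousLinearMap.lsmul_apply]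
  have e1 : ∀ x, inner ℝ (ψ x) (∫ t, ρ t • F (x - t)) = ∫ t, inner ℝ (ψ x) (ρ t • F (x - t)) := by
    intro x
    refine (integral_inner ?_ _).symm
    exact hρc.convolutionExists_left (ContinuousLinearMap.lsmul ℝ ℝ) hρ hFl x
  simp_rw [e1]
  rw [hswap]
  refine integral_congr_ae (Eventually.of_forall fun t => ?_)
  simp only [inner_smul_right]
  rw [integral_const_mul, smul_eq_mul]
  simp [sub_eq_add_neg]

/-- A sequence of bump functions at the origin with radii tending to zero. -/
noncomputable def mollifier (n : ℕ) : ContDiffBump (0 : ℂ) where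
  rIn := 1 / (2 * (n + 1))
  rOut := 1 / (n + 1)
  rIn_pos := by positivity
  rIn_lt_rOut := by
    apply one_div_lt_one_div_of_lt <;> linarith [n.cast_nonneg (α := ℝ)]

theorem tendsto_mollifier_rOut : Tendsto (fun n => (mollifier n).rOut) atTop (𝓝 0) :=
  tendsto_one_div_add_atTop_nhds_zero_nat

theorem mollifier_rOut_le (n : ℕ) : (mollifier n).rOut ≤ 1 := by
  show 1 / ((n : ℝ) + 1) ≤ 1
  rw [div_le_one (by positivity)]
  linarith [n.cast_nonneg (α := ℝ)]

/-- The convolution of `F` with the `n`-th mollifier. -/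
noncomputable def mollify {E : Type*} [NormedAddCommGroup E] [NormedSpace ℝ E] (n : ℕ)
    (F : ℂ → E) : ℂ → E :=
  (mollifier n).normed volume ⋆[ContinuousLinearMap.lsmul ℝ ℝ, volume] F

theorem contDiff_mollify {w : ℂ → ℝ} (hw : Continuous w) (n : ℕ) : ContDiff ℝ ∞ (mollify n w) :=
  (mollifier n).hasCompactSupport_normed.contDiff_convolution_left _
    (mollifier n).contDiff_normed hw.locallyIntegrable

theorem gradient_mollify {w : ℂ → ℝ} {G : ℂ → ℂ} (h : HasWeakGradient w G) (n : ℕ) (x : ℂ) :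
    gradient (mollify n w) x = mollify n G x :=
  gradient_convolution h (mollifier n).contDiff_normed (mollifier n).hasCompactSupport_normed x

theorem tendsto_mollify {w : ℂ → ℝ} (hw : Continuous w) (x : ℂ) :
    Tendsto (fun n => mollify n w x) atTop (𝓝 (w x)) :=
  ContDiffBump.convolution_tendsto_right_of_continuous tendsto_mollifier_rOut hw x

/-- Mollifications of a locally square-integrable field converge weakly in `L²_loc`. -/
theorem tendsto_integral_inner_mollify {ψ G : ℂ → ℂ} {R : ℝ} (hψ : MemLp ψ 2 volume)
    (hψR : ∀ x, ψ x ≠ 0 → x ∈ Metric.ball 0 R)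
    (hG : ∀ K : Set ℂ, IsCompact K → MemLp G 2 (volume.restrict K)) :
    Tendsto (fun n => ∫ x, inner ℝ (ψ x) (mollify n G x)) atTop
      (𝓝 (∫ x, inner ℝ (ψ x) (G x))) := by
  set B := Metric.closedBall (0 : ℂ) (R + 1) with hB
  have hBc : IsCompact B := isCompact_closedBall _ _
  set F := B.indicator G with hFdef
  have hF : MemLp F 2 volume := (memLp_indicator_iff_restrict hBc.measurableSet).2 (hG B hBc)
  have hlim := ContDiffBump.convolution_tendsto_right_of_continuous (μ := volume)
    tendsto_mollifier_rOut (continuous_integral_inner_add hψ hF) 0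
  have e0 : ∫ x, inner ℝ (ψ x) (F (x + 0)) = ∫ x, inner ℝ (ψ x) (G x) := by
    refine integral_congr_ae (Eventually.of_forall fun x => ?_)
    by_cases hx : ψ x = 0
    · simp [hx]
    · have : x ∈ B := by
        have := hψR x hx
        rw [mem_ball_zero_iff] at this
        rw [hB, mem_closedBall_zero_iff]
        linarith
      simp [hFdef, this]
  rw [e0] at hlim
  refine hlim.congr fun n => ?_
  rw [← integral_inner_convolution hψ hF (mollifier n).continuous_normed
    (mollifier n).hasCompactSupport_normed]
  refine integral_congr_ae (Eventually.of_forall fun x => ?_)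
  by_cases hx : ψ x = 0
  · simp [hx]
  · have hxR := hψR x hx
    rw [mem_ball_zero_iff] at hxR
    simp only [mollify, convolution_def]
    congr 1
    refine integral_congr_ae (Eventually.of_forall fun t => ?_)
    by_cases ht : t ∈ Metric.ball (0 : ℂ) (mollifier n).rOut
    · have : x - t ∈ B := by
        rw [mem_ball_zero_iff] at ht
        rw [hB, mem_closedBall_zero_iff]
        have := norm_sub_le x t
        linarith [mollifier_rOut_le n]
      simp [hFdef, this]
    · have : (mollifier n).normed volume t = 0 := by
        rw [← Function.notMem_support, (mollifier n).support_normed_eq]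
        exact ht
      simp [this]

/-! ### The energy identity -/

/-- Testing the equation `∇ · σ ∇ w = 0` with `χ² w`. -/
theorem integral_energy_eq {σ w : ℂ → ℝ} {G : ℂ → ℂ} {m : ℝ} (hσ : Measurable σ)
    (hσm : ∀ x, |σ x| ≤ m)
    (hw : Continuous w) (h : HasWeakGradient w G)
    (hG : ∀ K : Set ℂ, IsCompact K → MemLp G 2 (volume.restrict K))
    (hweak : ∀ φ : ℂ → ℝ, ContDiff ℝ ∞ φ → HasCompactSupport φ →
      ∫ x, σ x * inner ℝ (G x) (gradient φ x) = 0)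
    {χ : ℂ → ℝ} (hχ : ContDiff ℝ ∞ χ) (hχc : HasCompactSupport χ) :
    ∫ x, σ x * χ x ^ 2 * ‖G x‖ ^ 2
      = - ∫ x, 2 * σ x * χ x * w x * inner ℝ (G x) (gradient χ x) := by
  obtain ⟨R, hR⟩ := hχc.isCompact.isBounded.subset_ball 0
  set B := Metric.closedBall (0 : ℂ) (R + 1) with hB
  have hBc : IsCompact B := isCompact_closedBall _ _
  have hχB : ∀ x, x ∉ Metric.ball (0 : ℂ) R → χ x = 0 := fun x hx =>
    image_eq_zero_of_notMem_tsupport fun h => hx (hR h)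
  have hGl : LocallyIntegrable G := h.locallyIntegrable_grad
  obtain ⟨cχ, hcχ⟩ := hχ.continuous.bounded_above_of_compact_support hχc
  obtain ⟨cw, hcw⟩ := hBc.exists_bound_of_continuousOn hw.continuousOn
  -- the two terms of the tested equation
  set ψ : ℂ → ℂ := fun x => (σ x * χ x ^ 2) • G x with hψdef
  have hψsupp : ∀ x, ψ x ≠ 0 → x ∈ Metric.ball (0 : ℂ) R := by
    intro x hx
    by_contra hxB
    simp [hψdef, hχB x hxB] at hx
  have hmG : AEStronglyMeasurable G volume := hGl.aestronglyMeasurable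
  have hψ : MemLp ψ 2 volume := by
    have hF : MemLp (B.indicator G) 2 volume :=
      (memLp_indicator_iff_restrict hBc.measurableSet).2 (hG B hBc)
    refine MemLp.of_le_mul (c := m * cχ ^ 2) hF
      (((hσ.mul (hχ.continuous.measurable.pow_const 2)).aestronglyMeasurable).smul hmG)
      (Eventually.of_forall fun x => ?_)
    by_cases hx : x ∈ Metric.ball (0 : ℂ) R
    · have hxB : x ∈ B := Metric.ball_subset_closedBall
        (Metric.ball_subset_ball (by linarith) hx)
      rw [indicator_of_mem hxB, hψdef]
      simp only [norm_smul, norm_mul, norm_pow]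
      have := hcχ x
      have h1 := hσm x
      rw [← Real.norm_eq_abs] at h1
      gcongr
      exact (norm_nonneg _).trans h1
    · have : ψ x = 0 := by simp [hψdef, hχB x hx]
      rw [this, norm_zero]
      have : 0 ≤ m := (abs_nonneg _).trans (hσm x)
      positivity
  have lim1 := tendsto_integral_inner_mollify hψ hψsupp hG
  set s : ℂ → ℝ := fun x => 2 * σ x * χ x * inner ℝ (G x) (gradient χ x) with hsdef
  have hsm : AEStronglyMeasurable s volume :=
    (((measurable_const.mul hσ).mul hχ.continuous.measurable).aestronglyMeasurable).mul
      (hmG.inner (continuous_gradient hχ).aestronglyMeasurable)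
  have hs : Integrable s := by
    have hi : Integrable fun x => ‖gradient χ x‖ * ‖G x‖ := by
      have := (hGl.integrable_smul_left_of_hasCompactSupport
        (continuous_gradient hχ).norm (hasCompactSupport_gradient hχc).norm).norm
      simpa only [norm_smul, norm_norm] using this
    refine (hi.const_mul (2 * m * cχ)).mono' hsm (Eventually.of_forall fun x => ?_)
    have h1 := hσm x
    rw [← Real.norm_eq_abs] at h1
    have h2 := norm_inner_le_norm (𝕜 := ℝ) (G x) (gradient χ x)
    simp only [hsdef, norm_mul]
    have h0 : 0 ≤ m := (norm_nonneg _).trans h1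
    have := hcχ x
    have h3 : 0 ≤ cχ := (norm_nonneg _).trans this
    calc ‖(2 : ℝ)‖ * ‖σ x‖ * ‖χ x‖ * ‖inner ℝ (G x) (gradient χ x)‖
        ≤ 2 * m * cχ * (‖G x‖ * ‖gradient χ x‖) := by
          rw [Real.norm_ofNat]; gcongr
      _ = _ := by ring
  have hs0 : ∀ x, x ∉ Metric.ball (0 : ℂ) R → s x = 0 := fun x hx => by
    simp [hsdef, hχB x hx]
  have hbound : ∀ n, ∀ x ∈ Metric.ball (0 : ℂ) R, ‖mollify n w x‖ ≤ 3 * cw := by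
    intro n x hx
    rw [mem_ball_zero_iff] at hx
    have hxB : x ∈ B := by rw [hB, mem_closedBall_zero_iff]; linarith
    have := ContDiffBump.dist_normed_convolution_le (μ := volume) (φ := mollifier n) (x₀ := x)
      (ε := 2 * cw) hw.aestronglyMeasurable fun y hy => by
        have hyB : y ∈ B := by
          rw [hB, mem_closedBall_zero_iff]
          rw [mem_ball_iff_norm] at hy
          have := norm_le_norm_add_norm_sub x y
          rw [norm_sub_rev] at this
          linarith [mollifier_rOut_le n]
        rw [dist_eq_norm]
        linarith [norm_sub_le (w y) (w x), hcw y hyB, hcw x hxB]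
    rw [dist_eq_norm] at this
    have h2 := norm_le_norm_add_norm_sub (w x) (mollify n w x)
    rw [norm_sub_rev] at h2
    have h3 : ‖mollify n w x - w x‖ ≤ 2 * cw := this
    linarith [hcw x hxB]
  have lim2 : Tendsto (fun n => ∫ x, s x * mollify n w x) atTop (𝓝 (∫ x, s x * w x)) := by
    refine tendsto_integral_of_dominated_convergence (fun x => ‖s x‖ * (3 * cw)) (fun n => ?_)
      (hs.norm.mul_const _) (fun n => Eventually.of_forall fun x => ?_)
      (Eventually.of_forall fun x => (tendsto_mollify hw x).const_mul _)
    · exact hsm.mul (contDiff_mollify hw n).continuous.aestronglyMeasurable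
    · rw [norm_mul]
      by_cases hx : x ∈ Metric.ball (0 : ℂ) R
      · gcongr
        exact hbound n x hx
      · simp [hs0 x hx]
  have heq : ∀ n, ∫ x, inner ℝ (ψ x) (mollify n G x) = - ∫ x, s x * mollify n w x := by
    intro n
    have hwn := contDiff_mollify hw n
    have hφ : ContDiff ℝ ∞ fun x => χ x ^ 2 * mollify n w x := (hχ.pow 2).mul hwn
    have hφc : HasCompactSupport fun x => χ x ^ 2 * mollify n w x := by
      refine HasCompactSupport.mul_right ?_
      exact hχc.comp_left (g := fun t : ℝ => t ^ 2) (by simp)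
    have hgrad : ∀ x, gradient (fun x => χ x ^ 2 * mollify n w x) x
        = (χ x ^ 2) • mollify n G x + (2 * χ x * mollify n w x) • gradient χ x := by
      intro x
      have d1 : HasFDerivAt χ (fderiv ℝ χ x) x :=
        ((hχ.differentiable (by simp)) x).hasFDerivAt
      have d2 : HasFDerivAt (mollify n w) (fderiv ℝ (mollify n w) x) x :=
        ((hwn.differentiable (by simp)) x).hasFDerivAt
      have d3 := (d1.pow 2).mul d2
      have d4 : fderiv ℝ (fun x => χ x ^ 2 * mollify n w x) x = _ := HasFDerivAt.fderiv d3
      rw [gradient, d4, ← gradient_mollify h n x, gradient, gradient]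
      simp only [map_add, map_smul, smul_smul]
      congr 2
      simp
      ring
    have h0 := hweak _ hφ hφc
    have i1 : Integrable fun x => inner ℝ (ψ x) (mollify n G x) := by
      have hc : Continuous (mollify n G) := by
        have := continuous_gradient hwn
        rwa [show gradient (mollify n w) = mollify n G from funext (gradient_mollify h n)] at this
      obtain ⟨cM, hcM⟩ := hBc.exists_bound_of_continuousOn hc.continuousOn
      have hψi : Integrable ψ := by
        have : ψ = B.indicator ψ := by
          ext1 x
          by_cases hx : x ∈ B
          · simp [hx]
          · have : ψ x = 0 := by
              by_contra h'
              exact hx (Metric.ball_subset_closedBall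
                (Metric.ball_subset_ball (by linarith) (hψsupp x h')))
            simp [hx, this]
        rw [this, integrable_indicator_iff hBc.measurableSet]
        have : IsFiniteMeasure (volume.restrict B) := ⟨by simpa using hBc.measure_lt_top⟩
        exact (hψ.restrict B).integrable one_le_two
      refine (hψi.norm.mul_const cM).mono' (hψi.1.inner hc.aestronglyMeasurable)
        (Eventually.of_forall fun x => ?_)
      refine (norm_inner_le_norm _ _).trans ?_
      by_cases hx : ψ x = 0
      · simp [hx]
      · gcongr
        exact hcM x (Metric.ball_subset_closedBall
          (Metric.ball_subset_ball (by linarith) (hψsupp x hx)))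
    have i2 : Integrable fun x => s x * mollify n w x := by
      refine (hs.norm.mul_const (3 * cw)).mono' (hsm.mul hwn.continuous.aestronglyMeasurable)
        (Eventually.of_forall fun x => ?_)
      rw [norm_mul]
      by_cases hx : x ∈ Metric.ball (0 : ℂ) R
      · gcongr
        exact hbound n x hx
      · simp [hs0 x hx]
    have e : ∀ x, σ x * inner ℝ (G x) (gradient (fun x => χ x ^ 2 * mollify n w x) x)
        = inner ℝ (ψ x) (mollify n G x) + s x * mollify n w x := by
      intro x
      rw [hgrad, inner_add_right, inner_smul_right, inner_smul_right, hψdef, hsdef]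
      simp only [inner_smul_left]
      simp
      ring
    simp_rw [e] at h0
    rw [integral_add i1 i2] at h0
    linarith
  have := tendsto_nhds_unique (lim1.congr heq) lim2.neg
  have e1 : ∀ x, inner ℝ (ψ x) (G x) = σ x * χ x ^ 2 * ‖G x‖ ^ 2 := by
    intro x
    rw [hψdef]
    simp only [inner_smul_left, real_inner_self_eq_norm_sq]
    simp
  simp_rw [e1] at this
  rw [this]
  congr 1
  refine integral_congr_ae (Eventually.of_forall fun x => ?_)
  simp only [hsdef]
  ring

/-! ### Caccioppoli's inequality and uniqueness -/

theorem integrable_norm_gradient_sq {φ : ℂ → ℝ} (hφ : ContDiff ℝ ∞ φ)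
    (hφc : HasCompactSupport φ) : Integrable fun x => ‖gradient φ x‖ ^ 2 := by
  have h1 : HasCompactSupport fun x => ‖gradient φ x‖ := (hasCompactSupport_gradient hφc).norm
  have h2 : Continuous fun x => ‖gradient φ x‖ := (continuous_gradient hφ).norm
  simp_rw [pow_two]
  exact (h2.mul h2).integrable_of_hasCompactSupport h1.mul_left

/-- Caccioppoli's inequality. -/
theorem caccioppoli {σ w : ℂ → ℝ} {G : ℂ → ℂ} {m : ℝ} (hσ : Measurable σ)
    (hσ0 : ∀ x, 0 < σ x) (hσm : ∀ x, σ x ≤ m)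
    (hw : Continuous w) (h : HasWeakGradient w G)
    (hG : ∀ K : Set ℂ, IsCompact K → MemLp G 2 (volume.restrict K))
    (hweak : ∀ φ : ℂ → ℝ, ContDiff ℝ ∞ φ → HasCompactSupport φ →
      ∫ x, σ x * inner ℝ (G x) (gradient φ x) = 0)
    {χ : ℂ → ℝ} (hχ : ContDiff ℝ ∞ χ) (hχc : HasCompactSupport χ) :
    Integrable (fun x => σ x * χ x ^ 2 * ‖G x‖ ^ 2) ∧
      ∫ x, σ x * χ x ^ 2 * ‖G x‖ ^ 2 ≤ 4 * m * ∫ x, w x ^ 2 * ‖gradient χ x‖ ^ 2 := by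
  have hσa : ∀ x, |σ x| ≤ m := fun x => by rw [abs_of_pos (hσ0 x)]; exact hσm x
  have henergy := integral_energy_eq hσ hσa hw h hG hweak hχ hχc
  have hmG : AEStronglyMeasurable G volume := h.locallyIntegrable_grad.aestronglyMeasurable
  have hm0 : 0 ≤ m := (hσ0 0).le.trans (hσm 0)
  obtain ⟨cχ, hcχ⟩ := hχ.continuous.bounded_above_of_compact_support hχc
  have hG2 : Integrable fun x => (tsupport χ).indicator (fun x => ‖G x‖ ^ 2) x :=
    (integrable_indicator_iff hχc.isCompact.measurableSet).2
      ((hG _ hχc.isCompact).integrable_norm_pow two_ne_zero)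
  have i1 : Integrable (fun x => σ x * χ x ^ 2 * ‖G x‖ ^ 2) := by
    refine (hG2.const_mul (m * cχ ^ 2)).mono'
      (((hσ.mul (hχ.continuous.measurable.pow_const 2)).aestronglyMeasurable).mul
        (hmG.norm.pow 2)) (Eventually.of_forall fun x => ?_)
    by_cases hx : x ∈ tsupport χ
    · rw [indicator_of_mem hx]
      simp only [norm_mul, norm_pow, norm_norm]
      have h1 := hσa x
      rw [← Real.norm_eq_abs] at h1
      have := hcχ x
      gcongr
    · rw [indicator_of_notMem hx]
      simp [image_eq_zero_of_notMem_tsupport hx]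
  have i2 : Integrable fun x => w x ^ 2 * ‖gradient χ x‖ ^ 2 := by
    have h1 : HasCompactSupport fun x => ‖gradient χ x‖ := (hasCompactSupport_gradient hχc).norm
    have h2 : Continuous fun x => ‖gradient χ x‖ := (continuous_gradient hχ).norm
    have h3 := ((hw.pow 2).mul (h2.mul h2)).integrable_of_hasCompactSupport (μ := volume)
      (h1.mul_left (f := fun x => ‖gradient χ x‖)).mul_left
    simp_rw [pow_two] at h3 ⊢
    exact h3
  refine ⟨i1, ?_⟩
  have key : - ∫ x, 2 * σ x * χ x * w x * inner ℝ (G x) (gradient χ x)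
      ≤ ∫ x, ((1 / 2) * (σ x * χ x ^ 2 * ‖G x‖ ^ 2)
        + (2 * m) * (w x ^ 2 * ‖gradient χ x‖ ^ 2)) := by
    have hle : ∀ x, -(2 * σ x * χ x * w x * inner ℝ (G x) (gradient χ x))
        ≤ (1 / 2) * (σ x * χ x ^ 2 * ‖G x‖ ^ 2) + (2 * m) * (w x ^ 2 * ‖gradient χ x‖ ^ 2) := by
      intro x
      have h0 := (hσ0 x).le
      have h1 : |inner ℝ (G x) (gradient χ x)| ≤ ‖G x‖ * ‖gradient χ x‖ :=
        abs_real_inner_le_norm _ _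
      have h2 : -(χ x * w x * inner ℝ (G x) (gradient χ x))
          ≤ (|χ x| * ‖G x‖) * (|w x| * ‖gradient χ x‖) := by
        refine (neg_le_abs _).trans ?_
        rw [abs_mul, abs_mul]
        calc |χ x| * |w x| * |inner ℝ (G x) (gradient χ x)|
            ≤ |χ x| * |w x| * (‖G x‖ * ‖gradient χ x‖) := by gcongr
          _ = _ := by ring
      have h3 := sq_nonneg (|χ x| * ‖G x‖ - 2 * (|w x| * ‖gradient χ x‖))
      have h4 : -(2 * (χ x * w x * inner ℝ (G x) (gradient χ x)))
          ≤ 1 / 2 * (χ x ^ 2 * ‖G x‖ ^ 2) + 2 * (w x ^ 2 * ‖gradient χ x‖ ^ 2) := by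
        rw [← sq_abs (χ x), ← sq_abs (w x)]
        linarith
      have h5 := mul_le_mul_of_nonneg_left h4 h0
      have h6 : σ x * (w x ^ 2 * ‖gradient χ x‖ ^ 2) ≤ m * (w x ^ 2 * ‖gradient χ x‖ ^ 2) :=
        mul_le_mul_of_nonneg_right (hσm x) (by positivity)
      linarith
    have hi := (i1.const_mul (1 / 2)).add (i2.const_mul (2 * m))
    have hnn : ∀ x, 0 ≤ (1 / 2) * (σ x * χ x ^ 2 * ‖G x‖ ^ 2)
        + (2 * m) * (w x ^ 2 * ‖gradient χ x‖ ^ 2) := fun x => by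
      have := (hσ0 x).le
      positivity
    rw [← integral_neg]
    by_cases hint : Integrable fun x => -(2 * σ x * χ x * w x * inner ℝ (G x) (gradient χ x))
    · exact integral_mono hint hi hle
    · rw [integral_undef hint]
      exact integral_nonneg hnn
  rw [integral_add (i1.const_mul _) (i2.const_mul _), integral_const_mul, integral_const_mul]
    at key
  linarith

/-- Rescaled cut-off functions whose Dirichlet energy does not depend on the scale. -/
theorem exists_cutoff : ∃ c : ℝ, ∀ R : ℝ, 0 < R → ∃ χ : ℂ → ℝ, ContDiff ℝ ∞ χ ∧
    HasCompactSupport χ ∧ (∀ x ∈ Metric.ball (0 : ℂ) R, χ x = 1 ∧ gradient χ x = 0) ∧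
    ∫ x, ‖gradient χ x‖ ^ 2 ≤ c := by
  let b : ContDiffBump (0 : ℂ) := ⟨1, 2, one_pos, one_lt_two⟩
  refine ⟨∫ x, ‖gradient b x‖ ^ 2, fun R hR => ?_⟩
  have hone : ∀ x ∈ Metric.ball (0 : ℂ) R, b (R⁻¹ • x) = 1 := by
    intro x hx
    apply b.one_of_mem_closedBall
    rw [mem_ball_zero_iff] at hx
    rw [mem_closedBall_zero_iff, norm_smul, norm_inv, Real.norm_of_nonneg hR.le]
    show R⁻¹ * ‖x‖ ≤ 1
    rw [inv_mul_le_iff₀ hR]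
    linarith
  have hgr : ∀ x, gradient (fun x => b (R⁻¹ • x)) x = R⁻¹ • gradient b (R⁻¹ • x) := by
    intro x
    rw [gradient, gradient, ← map_smul, fderiv_comp_smul]
  refine ⟨fun x => b (R⁻¹ • x), b.contDiff.comp (contDiff_const_smul _),
    b.hasCompactSupport.comp_smul (inv_ne_zero hR.ne'), fun x hx => ⟨hone x hx, ?_⟩, ?_⟩
  · have : (fun x => b (R⁻¹ • x)) =ᶠ[𝓝 x] fun _ => (1 : ℝ) :=
      Filter.eventuallyEq_of_mem (Metric.isOpen_ball.mem_nhds hx) hone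
    rw [gradient, this.fderiv_eq]
    simp
  · simp_rw [hgr, norm_smul, mul_pow]
    rw [integral_const_mul, Measure.integral_comp_smul volume (fun y => ‖gradient b y‖ ^ 2)]
    simp only [finrank_real_complex, smul_eq_mul, ← mul_assoc]
    rw [norm_inv, Real.norm_of_nonneg hR.le, abs_of_nonneg (by positivity)]
    apply le_of_eq
    field_simp

theorem eq_zero_of_isSolution_zero {σ w : ℂ → ℝ} {m : ℝ} (hσ : Measurable σ)
    (hσ0 : ∀ x, 0 < σ x) (hσm : ∀ x, σ x ≤ m) (hw : IsSolution σ (fun _ => 0) w) (x : ℂ) :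
    w x = 0 := by
  obtain ⟨hwc, ⟨G, h, hG, hweak⟩, hdec⟩ := hw
  simp only [sub_zero] at hdec
  have hm0 : 0 ≤ m := (hσ0 0).le.trans (hσm 0)
  -- energy estimate on large disks
  obtain ⟨c, hc⟩ := exists_cutoff
  obtain ⟨D, hD⟩ := hdec.bound
  obtain ⟨R₀, hR₀⟩ : ∃ R₀ : ℝ, ∀ x : ℂ, R₀ ≤ ‖x‖ → ‖w x‖ ≤ D * ‖‖x‖⁻¹‖ := by
    rw [← comap_norm_atTop, eventually_comap] at hD
    obtain ⟨R₀, h⟩ := eventually_atTop.1 hD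
    exact ⟨R₀, fun x hx => h _ hx x rfl⟩
  have hest : ∀ r R : ℝ, 0 < R → R₀ ≤ R → r ≤ R →
      IntegrableOn (fun x => σ x * ‖G x‖ ^ 2) (Metric.ball 0 r) ∧
      ∫ x in Metric.ball 0 r, σ x * ‖G x‖ ^ 2 ≤ 4 * m * (D ^ 2 * c) * (R⁻¹) ^ 2 := by
    intro r R hR hRR hrR
    obtain ⟨χ, hχ, hχc, h1, h2⟩ := hc R hR
    obtain ⟨i1, i2⟩ := caccioppoli hσ hσ0 hσm hwc h hG hweak hχ hχc
    have heq : EqOn (fun x => σ x * χ x ^ 2 * ‖G x‖ ^ 2) (fun x => σ x * ‖G x‖ ^ 2)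
        (Metric.ball 0 r) := fun x hx => by
      simp [(h1 x (Metric.ball_subset_ball hrR hx)).1]
    refine ⟨(integrableOn_congr_fun heq measurableSet_ball).1 i1.integrableOn, ?_⟩
    rw [← setIntegral_congr_fun measurableSet_ball heq]
    have hnn : ∀ x, 0 ≤ σ x * χ x ^ 2 * ‖G x‖ ^ 2 := fun x => by
      have := (hσ0 x).le; positivity
    refine (setIntegral_le_integral i1 (Eventually.of_forall hnn)).trans (i2.trans ?_)
    have : ∫ x, w x ^ 2 * ‖gradient χ x‖ ^ 2 ≤ ∫ x, (D * R⁻¹) ^ 2 * ‖gradient χ x‖ ^ 2 := by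
      refine integral_mono_of_nonneg (Eventually.of_forall fun x => by positivity) ?_
        (Eventually.of_forall fun x => ?_)
      · exact (integrable_norm_gradient_sq hχ hχc).const_mul _
      · by_cases hx : x ∈ Metric.ball (0 : ℂ) R
        · simp [(h1 x hx).2]
        · rw [mem_ball_zero_iff, not_lt] at hx
          have h3 := hR₀ x (hRR.trans hx)
          have h4 : ‖w x‖ ≤ D * R⁻¹ := by
            refine h3.trans ?_
            rw [norm_inv, norm_norm]
            have hD0 : 0 ≤ D := by
              by_contra hneg
              have : 0 < ‖‖x‖⁻¹‖ := by
                rw [norm_inv, norm_norm]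
                exact inv_pos.2 (hR.trans_le hx)
              nlinarith [norm_nonneg (w x)]
            gcongr
          have h5 : w x ^ 2 ≤ (D * R⁻¹) ^ 2 := by
            rw [← sq_abs (w x), ← Real.norm_eq_abs]
            gcongr
          exact mul_le_mul_of_nonneg_right h5 (by positivity)
    rw [integral_const_mul] at this
    calc 4 * m * ∫ x, w x ^ 2 * ‖gradient χ x‖ ^ 2
        ≤ 4 * m * ((D * R⁻¹) ^ 2 * c) := by
          refine mul_le_mul_of_nonneg_left (this.trans ?_) (by positivity)
          exact mul_le_mul_of_nonneg_left h2 (by positivity)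
      _ = _ := by ring
  -- the weak gradient vanishes
  have hball : ∀ n : ℕ, ∀ᵐ x ∂volume, x ∈ Metric.ball (0 : ℂ) n → G x = 0 := by
    intro n
    have hlim : Tendsto (fun R : ℝ => 4 * m * (D ^ 2 * c) * (R⁻¹) ^ 2) atTop (𝓝 0) := by
      have := (tendsto_inv_atTop_zero (𝕜 := ℝ)).pow 2
      simpa using this.const_mul (4 * m * (D ^ 2 * c))
    have hle : ∫ x in Metric.ball 0 (n : ℝ), σ x * ‖G x‖ ^ 2 ≤ 0 := by
      refine ge_of_tendsto hlim ?_
      filter_upwards [eventually_gt_atTop 0, eventually_ge_atTop R₀, eventually_ge_atTop (n : ℝ)]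
        with R h1 h2 h3 using (hest n R h1 h2 h3).2
    have hi : IntegrableOn (fun x => σ x * ‖G x‖ ^ 2) (Metric.ball 0 (n : ℝ)) :=
      (hest n (max 1 (max R₀ n)) (by positivity) (by simp) (by simp)).1
    have hnn : ∀ x, 0 ≤ σ x * ‖G x‖ ^ 2 := fun x => by
      have := (hσ0 x).le; positivity
    have h0 := (setIntegral_eq_zero_iff_of_nonneg_ae (Eventually.of_forall hnn) hi).1
      (le_antisymm hle (integral_nonneg hnn))
    rw [Filter.EventuallyEq, ae_restrict_iff' measurableSet_ball] at h0
    filter_upwards [h0] with x hx hxn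
    have := hx hxn
    simpa [(hσ0 x).ne'] using this
  have hG0 : ∀ᵐ x ∂volume, G x = 0 := by
    filter_upwards [ae_all_iff.2 hball] with x hx
    obtain ⟨n, hn⟩ := exists_nat_gt ‖x‖
    exact hx n (by simpa using hn)
  -- hence the function is constant
  have hconst : ∀ x y, w x = w y := by
    intro x y
    refine tendsto_nhds_unique (tendsto_mollify hwc x) ?_
    refine (tendsto_mollify hwc y).congr fun n => ?_
    refine is_const_of_fderiv_eq_zero (𝕜 := ℝ)
      ((contDiff_mollify hwc n).differentiable (by simp)) (fun z => ?_) y x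
    have hz : gradient (mollify n w) z = 0 := by
      rw [gradient_mollify h n z, mollify, convolution_def]
      have h1 : ∀ᵐ t ∂volume, G (z - t) = 0 :=
        (Measure.measurePreserving_sub_left volume z).quasiMeasurePreserving.ae hG0
      rw [integral_eq_zero_of_ae]
      filter_upwards [h1] with t ht
      simp [ht]
    have := toDual_gradient (𝕜 := ℝ) (f := mollify n w) (x := z)
    rw [← this, hz, map_zero]
  have hlim : Tendsto w (Bornology.cobounded ℂ) (𝓝 0) :=
    hdec.trans_tendsto (tendsto_norm_cobounded_atTop.inv_tendsto_atTop)
  refine tendsto_nhds_unique ?_ hlim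
  exact tendsto_const_nhds.congr fun y => hconst x y

theorem HasWeakGradient.sub {f g : ℂ → ℝ} {F G : ℂ → ℂ} (hf : HasWeakGradient f F)
    (hg : HasWeakGradient g G) : HasWeakGradient (fun x => f x - g x) (fun x => F x - G x) where
  locallyIntegrable := hf.locallyIntegrable.sub hg.locallyIntegrable
  locallyIntegrable_grad := hf.locallyIntegrable_grad.sub hg.locallyIntegrable_grad
  integral_eq φ hφ hφc := by
    simp_rw [sub_smul, smul_sub]
    rw [integral_sub, integral_sub, hf.integral_eq φ hφ hφc, hg.integral_eq φ hφ hφc]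
    · ring
    · exact hf.locallyIntegrable_grad.integrable_smul_left_of_hasCompactSupport hφ.continuous hφc
    · exact hg.locallyIntegrable_grad.integrable_smul_left_of_hasCompactSupport hφ.continuous hφc
    · exact hf.locallyIntegrable.integrable_smul_right_of_hasCompactSupport
        (continuous_gradient hφ) (hasCompactSupport_gradient hφc)
    · exact hg.locallyIntegrable.integrable_smul_right_of_hasCompactSupport
        (continuous_gradient hφ) (hasCompactSupport_gradient hφc)

theorem integrable_mul_inner_gradient {σ : ℂ → ℝ} {G : ℂ → ℂ} {m : ℝ} (hσ : Measurable σ)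
    (hσm : ∀ x, |σ x| ≤ m) (hG : LocallyIntegrable G) {φ : ℂ → ℝ} (hφ : ContDiff ℝ ∞ φ)
    (hφc : HasCompactSupport φ) : Integrable fun x => σ x * inner ℝ (G x) (gradient φ x) := by
  have hi : Integrable fun x => ‖gradient φ x‖ * ‖G x‖ := by
    have := (hG.integrable_smul_left_of_hasCompactSupport
      (continuous_gradient hφ).norm (hasCompactSupport_gradient hφc).norm).norm
    simpa only [norm_smul, norm_norm] using this
  refine (hi.const_mul m).mono' (hσ.aestronglyMeasurable.mul
    (hG.aestronglyMeasurable.inner (continuous_gradient hφ).aestronglyMeasurable))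
    (Eventually.of_forall fun x => ?_)
  rw [norm_mul]
  have h1 := hσm x
  rw [← Real.norm_eq_abs] at h1
  have h2 := norm_inner_le_norm (𝕜 := ℝ) (G x) (gradient φ x)
  rw [mul_comm ‖gradient φ x‖]
  gcongr
  exact (norm_nonneg _).trans h1

theorem IsSolution.sub {σ H₁ H₂ u₁ u₂ : ℂ → ℝ} {m : ℝ} (hσ : Measurable σ)
    (hσm : ∀ x, |σ x| ≤ m) (h₁ : IsSolution σ H₁ u₁) (h₂ : IsSolution σ H₂ u₂) :
    IsSolution σ (fun x => H₁ x - H₂ x) (fun x => u₁ x - u₂ x) where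
  continuous := h₁.continuous.sub h₂.continuous
  weak := by
    obtain ⟨G₁, w₁, l₁, e₁⟩ := h₁.weak
    obtain ⟨G₂, w₂, l₂, e₂⟩ := h₂.weak
    refine ⟨_, w₁.sub w₂, fun K hK => (l₁ K hK).sub (l₂ K hK), fun φ hφ hφc => ?_⟩
    simp_rw [inner_sub_left, mul_sub]
    rw [integral_sub (integrable_mul_inner_gradient hσ hσm w₁.locallyIntegrable_grad hφ hφc)
      (integrable_mul_inner_gradient hσ hσm w₂.locallyIntegrable_grad hφ hφc), e₁ φ hφ hφc,
      e₂ φ hφ hφc, sub_zero]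
  decay := (h₁.decay.sub h₂.decay).congr_left fun x => by ring

theorem IsSolution.unique {σ H u v : ℂ → ℝ} {m : ℝ} (hσ : Measurable σ) (hσ0 : ∀ x, 0 < σ x)
    (hσm : ∀ x, σ x ≤ m) (hu : IsSolution σ H u) (hv : IsSolution σ H v) : u = v := by
  have h := IsSolution.sub hσ (fun x => (abs_of_pos (hσ0 x)).trans_le (hσm x)) hu hv
  simp only [sub_self] at h
  exact funext fun x => sub_eq_zero.1 (eq_zero_of_isSolution_zero hσ hσ0 hσm h x)

/-! ### Iterates of a hyperbolic Möbius map -/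

section

/-- The Möbius map with fixed points `±√a` and parameter `b`. For `0 < a` and `0 ≤ b` it maps the
right half-plane into itself, and these maps commute: the parameters compose like velocities. -/
noncomputable def mob (a b : ℝ) (z : ℂ) : ℂ := (z + b * a) / (1 + b * z)

/-- The parameter of the `k`-th iterate of `mob a β`. -/
noncomputable def mobParam (a β : ℝ) : ℕ → ℝ
  | 0 => 0
  | k + 1 => (mobParam a β k + β) / (1 + mobParam a β k * β * a)

variable {a b β : ℝ} {z : ℂ}

theorem mob_zero (a : ℝ) (z : ℂ) : mob a 0 z = z := by simp [mob]

theorem one_le_re_one_add (hb : 0 ≤ b) (hz : 0 < z.re) : 1 ≤ (1 + b * z : ℂ).re := by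
  simp
  positivity

theorem one_le_norm_one_add (hb : 0 ≤ b) (hz : 0 < z.re) : 1 ≤ ‖(1 + b * z : ℂ)‖ :=
  (one_le_re_one_add hb hz).trans (re_le_norm _)

theorem one_add_ne_zero (hb : 0 ≤ b) (hz : 0 < z.re) : (1 + b * z : ℂ) ≠ 0 :=
  norm_pos_iff.1 (one_pos.trans_le (one_le_norm_one_add hb hz))

theorem mob_re_pos (ha : 0 < a) (hb : 0 ≤ b) (hz : 0 < z.re) : 0 < (mob a b z).re := by
  have hn : 0 < normSq (1 + b * z : ℂ) := normSq_pos.2 (one_add_ne_zero hb hz)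
  rw [mob, div_re, ← add_div]
  refine div_pos ?_ hn
  simp
  have : 0 ≤ (z.re + b * a) * (b * z.re) + z.im * (b * z.im) + b * a := by
    have : 0 ≤ b * (z.im * z.im) := mul_nonneg hb (mul_self_nonneg _)
    have : 0 ≤ (z.re + b * a) * (b * z.re) := by positivity
    have : 0 ≤ b * a := by positivity
    linarith
  linarith

theorem mob_mob (ha : 0 < a) (hb : 0 ≤ b) (hβ : 0 ≤ β) (hz : 0 < z.re) :
    mob a b (mob a β z) = mob a ((b + β) / (1 + b * β * a)) z := by
  have h1 := one_add_ne_zero hβ hz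
  have h3 : (1 + b * β * a : ℂ) ≠ 0 := by
    have : (0 : ℝ) < 1 + b * β * a := by positivity
    exact_mod_cast this.ne'
  have e1 : mob a b (mob a β z)
      = ((z + β * a) + b * a * (1 + β * z)) / ((1 + β * z) + b * (z + β * a)) := by
    rw [mob, mob, ← mul_div_mul_right _ _ h1]
    generalize (1 + β * z : ℂ) = X at h1 ⊢
    congr 1 <;> field_simp
  have e2 : mob a ((b + β) / (1 + b * β * a)) z
      = (z * (1 + b * β * a) + (b + β) * a) / ((1 + b * β * a) + (b + β) * z) := by
    rw [mob, ← mul_div_mul_right _ _ h3]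
    push_cast
    congr 1 <;> field_simp
  rw [e1, e2]
  congr 1 <;> ring

theorem norm_mob_le (ha : 0 < a) (hb : 0 ≤ b) (hba : b ^ 2 * a ≤ 1) (hz : 0 < z.re) :
    ‖mob a b z‖ ≤ ‖z‖ + √a := by
  rw [mob, norm_div]
  have h1 : b * a ≤ √a := by
    refine Real.le_sqrt_of_sq_le ?_
    nlinarith
  have h2 : ‖z + b * a‖ ≤ ‖z‖ + √a := by
    refine (norm_add_le _ _).trans ?_
    have : ‖(b * a : ℂ)‖ = b * a := by
      rw [← ofReal_mul, Complex.norm_of_nonneg (by positivity)]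
    linarith
  exact (div_le_self (norm_nonneg _) (one_le_norm_one_add hb hz)).trans h2

theorem hasDerivAt_mob (hb : 0 ≤ b) (hz : 0 < z.re) :
    HasDerivAt (mob a b) ((1 - b ^ 2 * a : ℝ) / (1 + b * z) ^ 2) z := by
  have h := one_add_ne_zero hb hz
  have h1 : HasDerivAt (fun z : ℂ => z + b * a) 1 z := (hasDerivAt_id z).add_const _
  have h2 : HasDerivAt (fun z : ℂ => 1 + b * z) b z := by
    simpa using ((hasDerivAt_id z).const_mul (b : ℂ)).const_add 1
  refine (h1.div h2 h).congr_deriv ?_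
  push_cast
  congr 1
  ring

theorem mobParam_nonneg (ha : 0 < a) (hβ : 0 < β) (k : ℕ) : 0 ≤ mobParam a β k := by
  induction k with
  | zero => exact le_rfl
  | succ k ih => rw [mobParam]; positivity

theorem mobParam_sq_mul_le (ha : 0 < a) (hβ : 0 < β) (hβa : β ^ 2 * a ≤ 1) (k : ℕ) :
    mobParam a β k ^ 2 * a ≤ 1 := by
  induction k with
  | zero => simp [mobParam]
  | succ k ih =>
    have h0 := mobParam_nonneg ha hβ k
    rw [mobParam, div_pow, div_mul_eq_mul_div, div_le_one (by positivity)]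
    nlinarith [mul_nonneg (sub_nonneg.2 ih) (sub_nonneg.2 hβa)]

theorem mobParam_succ_le (ha : 0 < a) (hβ : 0 < β) (k : ℕ) :
    mobParam a β (k + 1) ≤ mobParam a β k + β := by
  have h0 := mobParam_nonneg ha hβ k
  rw [mobParam]
  refine div_le_self (by positivity) ?_
  have : 0 ≤ mobParam a β k * β * a := by positivity
  linarith

theorem mul_one_sub_le_mobParam_succ_sub (ha : 0 < a) (hβ : 0 < β) (hβa : β ^ 2 * a ≤ 1) (k : ℕ) :
    β * (1 - mobParam a β k ^ 2 * a) ≤ 2 * (mobParam a β (k + 1) - mobParam a β k) := by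
  have h0 := mobParam_nonneg ha hβ k
  have h1 := mobParam_sq_mul_le ha hβ hβa k
  set b := mobParam a β k with hb
  have hD : 0 < 1 + b * β * a := by positivity
  have e : mobParam a β (k + 1) - b = β * (1 - b ^ 2 * a) / (1 + b * β * a) := by
    rw [mobParam, ← hb]
    field_simp
    ring
  have h2 : b * β * a ≤ 1 := by nlinarith [sq_nonneg (b - β), mul_nonneg ha.le (sq_nonneg (b - β))]
  rw [e, ← mul_div_assoc, le_div_iff₀ hD]
  nlinarith [mul_nonneg hβ.le (sub_nonneg.2 h1)]

theorem mobParam_mono (ha : 0 < a) (hβ : 0 < β) (hβa : β ^ 2 * a ≤ 1) (k : ℕ) :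
    mobParam a β k ≤ mobParam a β (k + 1) := by
  have := mul_one_sub_le_mobParam_succ_sub ha hβ hβa k
  have := mul_nonneg hβ.le (sub_nonneg.2 (mobParam_sq_mul_le ha hβ hβa k))
  linarith

theorem mob_mobParam_succ (ha : 0 < a) (hβ : 0 < β) (k : ℕ) (hz : 0 < z.re) :
    mob a (mobParam a β (k + 1)) z = mob a (mobParam a β k) (mob a β z) := by
  rw [mob_mob ha (mobParam_nonneg ha hβ k) hβ.le hz, mobParam]

theorem one_add_mul_norm_sq_le (hb : 0 ≤ b) (hz : 0 < z.re) :
    (1 + b * ‖z‖) ^ 2 ≤ 2 * ‖(1 + b * z : ℂ)‖ ^ 2 := by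
  have h1 : ‖(1 + b * z : ℂ)‖ ^ 2 = 1 + 2 * b * z.re + b ^ 2 * ‖z‖ ^ 2 := by
    rw [Complex.sq_norm, Complex.sq_norm, normSq_apply, normSq_apply]
    simp
    ring
  have : 0 ≤ b * z.re := by positivity
  rw [h1]
  nlinarith [sq_nonneg (1 - b * ‖z‖)]

/-- Uniform bound for `∑ |T^k z| |(T^k)' z|` over the iterates of `T = mob a β`: in terms of the
parameters `b_k` of the iterates this is a Riemann sum of
`(|z| + a b) / |1 + b z|^3`, and telescoping majorants are available for both summands. -/
theorem sum_norm_mob_mul_norm_deriv_le (ha : 0 < a) (hβ : 0 < β) (hβa : β ^ 2 * a ≤ 1)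
    (hz : 0 < z.re) (N : ℕ) :
    ∑ k ∈ Finset.range N, ‖mob a (mobParam a β k) z‖ *
      ‖((1 - mobParam a β k ^ 2 * a : ℝ) / (1 + mobParam a β k * z) ^ 2 : ℂ)‖
      ≤ 5 / β + 4 * ‖z‖ := by
  set B := mobParam a β with hB
  have hb0 : ∀ k, 0 ≤ B k := mobParam_nonneg ha hβ
  have hb1 : ∀ k, B k ^ 2 * a ≤ 1 := mobParam_sq_mul_le ha hβ hβa
  have hz0 : 0 < ‖z‖ := hz.trans_le (re_le_norm z)
  set P : ℕ → ℝ := fun k => 4 * (1 + β * ‖z‖) / β * (1 - 1 / (1 + B k * ‖z‖))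
    + a * B k ^ 2 / β with hP
  have hstep : ∀ k, ‖mob a (B k) z‖ * ‖((1 - B k ^ 2 * a : ℝ) / (1 + B k * z) ^ 2 : ℂ)‖
      ≤ P (k + 1) - P k := by
    intro k
    set b := B k with hbk
    set b' := B (k + 1) with hbk'
    have h0 : 0 ≤ b := hb0 k
    have h1 : b ^ 2 * a ≤ 1 := hb1 k
    have hmono : b ≤ b' := mobParam_mono ha hβ hβa k
    have hle : b' ≤ b + β := mobParam_succ_le ha hβ k
    have hinc : β * (1 - b ^ 2 * a) ≤ 2 * (b' - b) := mul_one_sub_le_mobParam_succ_sub ha hβ hβa k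
    have hD : 1 ≤ ‖(1 + b * z : ℂ)‖ := one_le_norm_one_add h0 hz
    have hD2 := one_add_mul_norm_sq_le h0 hz
    set D := ‖(1 + b * z : ℂ)‖ with hDdef
    have e1 : ‖mob a b z‖ ≤ ‖z‖ + b * a := by
      rw [mob, norm_div]
      refine (div_le_self (norm_nonneg _) hD).trans ((norm_add_le _ _).trans ?_)
      rw [← ofReal_mul, Complex.norm_of_nonneg (by positivity)]
    have e2 : ‖((1 - b ^ 2 * a : ℝ) / (1 + b * z) ^ 2 : ℂ)‖ = (1 - b ^ 2 * a) / D ^ 2 := by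
      rw [norm_div, Complex.norm_of_nonneg (by linarith), norm_pow]
    have hX : 0 < 1 + b * ‖z‖ := by positivity
    have hY : 0 < 1 + b' * ‖z‖ := by have := h0.trans hmono; positivity
    rw [e2]
    have e3 : (1 - b ^ 2 * a) / D ^ 2 ≤ 2 * (1 - b ^ 2 * a) / (1 + b * ‖z‖) ^ 2 := by
      rw [div_le_div_iff₀ (by positivity) (by positivity)]
      nlinarith [mul_le_mul_of_nonneg_left hD2 (sub_nonneg.2 h1)]
    have e4 : (1 - b ^ 2 * a) / D ^ 2 ≤ 1 - b ^ 2 * a :=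
      div_le_self (by linarith) (by nlinarith)
    have e5 : 1 - b ^ 2 * a ≤ 2 * (b' - b) / β := by
      rw [le_div_iff₀ hβ]; linarith
    -- the two telescoping increments
    have f1 : ‖z‖ * ((1 - b ^ 2 * a) / D ^ 2)
        ≤ 4 * (1 + β * ‖z‖) / β * (1 / (1 + b * ‖z‖) - 1 / (1 + b' * ‖z‖)) := by
      have g1 : 1 / (1 + b * ‖z‖) - 1 / (1 + b' * ‖z‖)
          = (b' - b) * ‖z‖ / ((1 + b * ‖z‖) * (1 + b' * ‖z‖)) := by
        rw [div_sub_div _ _ hX.ne' hY.ne']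
        congr 1
        ring
      have g2 : 1 + b' * ‖z‖ ≤ (1 + β * ‖z‖) * (1 + b * ‖z‖) := by
        nlinarith [mul_le_mul_of_nonneg_right hle hz0.le,
          mul_nonneg (mul_nonneg hβ.le h0) (mul_nonneg hz0.le hz0.le)]
      rw [g1]
      calc ‖z‖ * ((1 - b ^ 2 * a) / D ^ 2)
          ≤ ‖z‖ * (2 * (2 * (b' - b) / β) / (1 + b * ‖z‖) ^ 2) := by
            refine mul_le_mul_of_nonneg_left (e3.trans ?_) hz0.le
            gcongr
        _ = 4 / β * ((b' - b) * ‖z‖) * (1 / (1 + b * ‖z‖) ^ 2) := by ring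
        _ ≤ 4 / β * ((b' - b) * ‖z‖) *
            ((1 + β * ‖z‖) / ((1 + b * ‖z‖) * (1 + b' * ‖z‖))) := by
            have : 0 ≤ b' - b := sub_nonneg.2 hmono
            refine mul_le_mul_of_nonneg_left ?_ (by positivity)
            rw [div_le_div_iff₀ (by positivity) (by positivity)]
            nlinarith [mul_le_mul_of_nonneg_right g2 hX.le]
        _ = _ := by ring
    have f2 : b * a * ((1 - b ^ 2 * a) / D ^ 2) ≤ a * b' ^ 2 / β - a * b ^ 2 / β := by
      calc b * a * ((1 - b ^ 2 * a) / D ^ 2) ≤ b * a * (2 * (b' - b) / β) :=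
            mul_le_mul_of_nonneg_left (e4.trans e5) (by positivity)
        _ = a / β * (2 * b * (b' - b)) := by ring
        _ ≤ a / β * (b' ^ 2 - b ^ 2) := by
            refine mul_le_mul_of_nonneg_left ?_ (by positivity)
            nlinarith [sq_nonneg (b' - b)]
        _ = _ := by ring
    calc ‖mob a b z‖ * ((1 - b ^ 2 * a) / D ^ 2)
        ≤ (‖z‖ + b * a) * ((1 - b ^ 2 * a) / D ^ 2) := by
          refine mul_le_mul_of_nonneg_right e1 (div_nonneg (by linarith) (by positivity))
      _ ≤ P (k + 1) - P k := by
          simp only [hP, ← hbk, ← hbk']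
          linarith
  calc _ ≤ ∑ k ∈ Finset.range N, (P (k + 1) - P k) := Finset.sum_le_sum fun k _ => hstep k
    _ = P N - P 0 := Finset.sum_range_sub P N
    _ ≤ 5 / β + 4 * ‖z‖ := by
      have hP0 : P 0 = 0 := by simp [hP, hB, mobParam]
      have h1 : a * B N ^ 2 / β ≤ 1 / β := by
        have := hb1 N
        gcongr
        linarith
      have h2 : 4 * (1 + β * ‖z‖) / β * (1 - 1 / (1 + B N * ‖z‖)) ≤ 4 * (1 + β * ‖z‖) / β * 1 := by
        have : 0 ≤ 1 / (1 + B N * ‖z‖) := by have := hb0 N; positivity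
        refine mul_le_mul_of_nonneg_left (by linarith) (by positivity)
      have h3 : 4 * (1 + β * ‖z‖) / β * 1 = 4 / β + 4 * ‖z‖ := by field_simp
      have h4 : (5 : ℝ) / β = 4 / β + 1 / β := by ring
      rw [hP0, h4]
      simp only [hP]
      linarith

end

/-! ### Series of images -/

/-- The series `∑ μ ^ k f (T ^ k z)` over the iterates of `T = mob a β`, which solves
`S = f + μ S ∘ T`. -/
noncomputable def imageSeries (a β μ : ℝ) (f : ℂ → ℂ) (z : ℂ) : ℂ :=
  ∑' k : ℕ, (μ : ℂ) ^ k * f (mob a (mobParam a β k) z)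

theorem isOpen_re_pos : IsOpen {z : ℂ | 0 < z.re} := isOpen_lt continuous_const continuous_re

section
variable {a β μ : ℝ} {f : ℂ → ℂ}

theorem exists_norm_comp_mob_le (ha : 0 < a) (hβ : 0 < β) (hβa : β ^ 2 * a ≤ 1)
    (hf : Differentiable ℂ f) (R : ℝ) :
    ∃ C : ℝ, ∀ k, ∀ z : ℂ, 0 < z.re → ‖z‖ ≤ R → ‖f (mob a (mobParam a β k) z)‖ ≤ C := by
  obtain ⟨C, hC⟩ := (isCompact_closedBall (0 : ℂ) (R + √a)).exists_bound_of_continuousOn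
    hf.continuous.continuousOn
  refine ⟨C, fun k z hz hzR => hC _ ?_⟩
  rw [mem_closedBall_zero_iff]
  linarith [norm_mob_le ha (mobParam_nonneg ha hβ k) (mobParam_sq_mul_le ha hβ hβa k) hz]

theorem summable_imageSeries (ha : 0 < a) (hβ : 0 < β) (hβa : β ^ 2 * a ≤ 1) (hμ : |μ| < 1)
    (hf : Differentiable ℂ f) {z : ℂ} (hz : 0 < z.re) :
    Summable fun k : ℕ => (μ : ℂ) ^ k * f (mob a (mobParam a β k) z) := by
  obtain ⟨C, hC⟩ := exists_norm_comp_mob_le ha hβ hβa hf ‖z‖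
  refine Summable.of_norm_bounded
    ((summable_geometric_of_lt_one (abs_nonneg μ) hμ).mul_right C) fun k => ?_
  rw [norm_mul, norm_pow, norm_real, Real.norm_eq_abs]
  exact mul_le_mul_of_nonneg_left (hC k z hz le_rfl) (by positivity)

theorem imageSeries_mob (ha : 0 < a) (hβ : 0 < β) {z : ℂ} (hz : 0 < z.re) :
    imageSeries a β μ f (mob a β z)
      = ∑' k : ℕ, (μ : ℂ) ^ k * f (mob a (mobParam a β (k + 1)) z) := by
  simp_rw [imageSeries, mob_mobParam_succ ha hβ _ hz]

theorem imageSeries_eq (ha : 0 < a) (hβ : 0 < β) (hβa : β ^ 2 * a ≤ 1) (hμ : |μ| < 1)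
    (hf : Differentiable ℂ f) {z : ℂ} (hz : 0 < z.re) :
    imageSeries a β μ f z = f z + μ * imageSeries a β μ f (mob a β z) := by
  rw [imageSeries_mob ha hβ hz, imageSeries,
    (summable_imageSeries ha hβ hβa hμ hf hz).tsum_eq_zero_add, ← tsum_mul_left]
  congr 1
  · simp [mobParam, mob_zero]
  · exact tsum_congr fun k => by ring

theorem imageSeries_const_mul (c : ℂ) (z : ℂ) :
    imageSeries a β μ (fun z => c * f z) z = c * imageSeries a β μ f z := by
  rw [imageSeries, imageSeries, ← tsum_mul_left]
  exact tsum_congr fun k => by ring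

theorem differentiableAt_imageSeries (ha : 0 < a) (hβ : 0 < β) (hβa : β ^ 2 * a ≤ 1)
    (hμ : |μ| < 1) (hf : Differentiable ℂ f) {z : ℂ} (hz : 0 < z.re) :
    DifferentiableAt ℂ (imageSeries a β μ f) z := by
  set U := {z : ℂ | 0 < z.re} ∩ Metric.ball 0 (‖z‖ + 1) with hU
  have hUo : IsOpen U := isOpen_re_pos.inter Metric.isOpen_ball
  obtain ⟨C, hC⟩ := exists_norm_comp_mob_le ha hβ hβa hf (‖z‖ + 1)
  have h : DifferentiableOn ℂ (imageSeries a β μ f) U := by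
    refine differentiableOn_tsum_of_summable_norm
      ((summable_geometric_of_lt_one (abs_nonneg μ) hμ).mul_right C) (fun k w hw => ?_) hUo
      fun k w hw => ?_
    · have hd := (hasDerivAt_mob (a := a) (mobParam_nonneg ha hβ k) hw.1).differentiableAt
      exact (((hf _).comp w hd).const_mul _).differentiableWithinAt
    · rw [norm_mul, norm_pow, norm_real, Real.norm_eq_abs]
      exact mul_le_mul_of_nonneg_left (hC k w hw.1 (mem_ball_zero_iff.1 hw.2).le) (by positivity)
  exact h.differentiableAt (hUo.mem_nhds ⟨hz, by simp⟩)

theorem differentiableAt_imageSeries_mob (ha : 0 < a) (hβ : 0 < β) (hβa : β ^ 2 * a ≤ 1)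
    (hμ : |μ| < 1) (hf : Differentiable ℂ f) {z : ℂ} (hz : 0 < z.re) :
    DifferentiableAt ℂ (fun z => imageSeries a β μ f (mob a β z)) z :=
  (differentiableAt_imageSeries ha hβ hβa hμ hf (mob_re_pos ha hβ.le hz)).comp z
    (hasDerivAt_mob hβ.le hz).differentiableAt

/-- If `f' (z) = O(z)`, then series over the images `f (T ^ k z)` with bounded coefficients are
Lipschitz, uniformly in the coefficients. -/
theorem lipschitzOnWith_of_hasSum_mob (ha : 0 < a) (hβ : 0 < β) (hβa : β ^ 2 * a ≤ 1)
    (hf : Differentiable ℂ f) {M R : ℝ} {s : Set ℂ} (hM : 0 ≤ M) (hs : Convex ℝ s)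
    (hsP : ∀ z ∈ s, 0 < z.re) (hsR : ∀ z ∈ s, ‖z‖ ≤ R)
    (hderiv : ∀ w : ℂ, ‖w‖ ≤ R + √a → ‖deriv f w‖ ≤ M * ‖w‖) {c : ℕ → ℂ} (hc : ∀ k, ‖c k‖ ≤ 1)
    {F : ℂ → ℂ} (hF : ∀ z ∈ s, HasSum (fun k => c k * f (mob a (mobParam a β k) z)) (F z)) :
    LipschitzOnWith (M * (5 / β + 4 * R)).toNNReal F s := by
  have hpart : ∀ N, LipschitzOnWith (M * (5 / β + 4 * R)).toNNReal
      (fun z => ∑ k ∈ Finset.range N, c k * f (mob a (mobParam a β k) z)) s := by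
    intro N
    have hd : ∀ z ∈ s, HasDerivAt
        (fun z => ∑ k ∈ Finset.range N, c k * f (mob a (mobParam a β k) z))
        (∑ k ∈ Finset.range N, c k * (deriv f (mob a (mobParam a β k) z) *
          ((1 - mobParam a β k ^ 2 * a : ℝ) / (1 + mobParam a β k * z) ^ 2))) z := by
      intro z hz
      refine HasDerivAt.fun_sum fun k _ => ?_
      exact ((hf _).hasDerivAt.comp z
        (hasDerivAt_mob (a := a) (mobParam_nonneg ha hβ k) (hsP z hz))).const_mul _
    refine Convex.lipschitzOnWith_of_nnnorm_deriv_le (fun z hz => (hd z hz).differentiableAt)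
      (fun z hz => ?_) hs
    rw [← NNReal.coe_le_coe, coe_nnnorm, (hd z hz).deriv]
    refine le_trans ?_ (Real.le_coe_toNNReal _)
    have hzP := hsP z hz
    calc _ ≤ ∑ k ∈ Finset.range N, M * (‖mob a (mobParam a β k) z‖ *
          ‖((1 - mobParam a β k ^ 2 * a : ℝ) / (1 + mobParam a β k * z) ^ 2 : ℂ)‖) := by
          refine norm_sum_le_of_le _ fun k _ => ?_
          rw [norm_mul, norm_mul, ← mul_assoc M]
          have h1 : ‖deriv f (mob a (mobParam a β k) z)‖ ≤ M * ‖mob a (mobParam a β k) z‖ :=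
            hderiv _ ((norm_mob_le ha (mobParam_nonneg ha hβ k)
              (mobParam_sq_mul_le ha hβ hβa k) hzP).trans (by linarith [hsR z hz]))
          refine (mul_le_of_le_one_left (by positivity) (hc k)).trans ?_
          gcongr
      _ ≤ M * (5 / β + 4 * ‖z‖) := by
          rw [← Finset.mul_sum]
          exact mul_le_mul_of_nonneg_left
            (sum_norm_mob_mul_norm_deriv_le ha hβ hβa hzP N) hM
      _ ≤ M * (5 / β + 4 * R) := by
          have := hsR z hz
          gcongr
  refine LipschitzOnWith.of_dist_le_mul fun x hx y hy => ?_
  exact le_of_tendsto ((hF x hx).tendsto_sum_nat.dist (hF y hy).tendsto_sum_nat)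
    (Eventually.of_forall fun N => (hpart N).dist_le_mul x hx y hy)

theorem lipschitzOnWith_imageSeries (ha : 0 < a) (hβ : 0 < β) (hβa : β ^ 2 * a ≤ 1)
    (hμ : |μ| < 1) (hf : Differentiable ℂ f) {M R : ℝ} {s : Set ℂ} (hM : 0 ≤ M)
    (hs : Convex ℝ s) (hsP : ∀ z ∈ s, 0 < z.re) (hsR : ∀ z ∈ s, ‖z‖ ≤ R)
    (hderiv : ∀ w : ℂ, ‖w‖ ≤ R + √a → ‖deriv f w‖ ≤ M * ‖w‖) :
    LipschitzOnWith (M * (5 / β + 4 * R)).toNNReal (imageSeries a β μ f) s := by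
  refine lipschitzOnWith_of_hasSum_mob ha hβ hβa hf hM hs hsP hsR hderiv
    (c := fun k => (μ : ℂ) ^ k) (fun k => ?_) fun z hz =>
      (summable_imageSeries ha hβ hβa hμ hf (hsP z hz)).hasSum
  rw [norm_pow, norm_real, Real.norm_eq_abs]
  exact pow_le_one₀ (abs_nonneg μ) hμ.le

theorem lipschitzOnWith_imageSeries_mob (ha : 0 < a) (hβ : 0 < β) (hβa : β ^ 2 * a ≤ 1)
    (hμ : |μ| < 1) (hf : Differentiable ℂ f) {M R : ℝ} {s : Set ℂ} (hM : 0 ≤ M)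
    (hs : Convex ℝ s) (hsP : ∀ z ∈ s, 0 < z.re) (hsR : ∀ z ∈ s, ‖z‖ ≤ R)
    (hderiv : ∀ w : ℂ, ‖w‖ ≤ R + √a → ‖deriv f w‖ ≤ M * ‖w‖) :
    LipschitzOnWith (M * (5 / β + 4 * R)).toNNReal
      (fun z => imageSeries a β μ f (mob a β z)) s := by
  refine lipschitzOnWith_of_hasSum_mob ha hβ hβa hf hM hs hsP hsR hderiv
    (c := fun k => if k = 0 then 0 else (μ : ℂ) ^ (k - 1)) (fun k => ?_) fun z hz => ?_
  · by_cases hk : k = 0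
    · simp [hk]
    · simp only [hk, if_false]
      rw [norm_pow, norm_real, Real.norm_eq_abs]
      exact pow_le_one₀ (abs_nonneg μ) hμ.le
  · have h := (summable_imageSeries ha hβ hβa hμ hf (mob_re_pos ha hβ.le (hsP z hz))).hasSum
    refine (hasSum_nat_add_iff' 1).1 ?_
    simpa [imageSeries, mob_mobParam_succ ha hβ _ (hsP z hz)] using h

end

theorem exists_lipschitzOnWith_of_differentiableAt {F : ℂ → ℂ} {U s : Set ℂ} (hU : IsOpen U)
    (hF : ∀ z ∈ U, DifferentiableAt ℂ F z) (hsU : s ⊆ U) (hs : Convex ℝ s) (hsc : IsCompact s) :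
    ∃ K : ℝ≥0, LipschitzOnWith K F s := by
  have hd : DifferentiableOn ℂ F U := fun z hz => (hF z hz).differentiableWithinAt
  obtain ⟨C, hC⟩ := hsc.exists_bound_of_continuousOn ((hd.deriv hU).continuousOn.mono hsU)
  refine ⟨C.toNNReal, Convex.lipschitzOnWith_of_nnnorm_deriv_le (fun z hz => hF z (hsU hz))
    (fun z hz => ?_) hs⟩
  rw [← NNReal.coe_le_coe, coe_nnnorm]
  exact (hC z hz).trans (Real.le_coe_toNNReal C)

/-! ### Inversions in two circles -/

/-- The inversion in the circle with real centre `c` and radius `r`; the centre itself is sent to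
`c`, by the convention for division by zero. -/
noncomputable def refl (c r : ℝ) (z : ℂ) : ℂ := c + r ^ 2 / conj (z - c)

theorem refl_sub_center (c r : ℝ) (z : ℂ) : refl c r z - c = r ^ 2 / conj (z - c) := by
  simp [refl]

theorem norm_refl_sub_center (c r : ℝ) (z : ℂ) : ‖refl c r z - c‖ = r ^ 2 / ‖z - c‖ := by
  rw [refl_sub_center, norm_div, norm_conj, norm_pow, norm_real, Real.norm_eq_abs, sq_abs]

theorem refl_mem_closedBall {c r : ℝ} (hr : 0 < r) {z : ℂ} (hz : z ∉ Metric.ball (c : ℂ) r) :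
    refl c r z ∈ Metric.closedBall (c : ℂ) r := by
  rw [mem_ball_iff_norm, not_lt] at hz
  rw [mem_closedBall_iff_norm, norm_refl_sub_center, div_le_iff₀ (hr.trans_le hz), pow_two]
  gcongr

theorem refl_of_mem_sphere {c r : ℝ} (hr : 0 < r) {z : ℂ} (hz : ‖z - c‖ = r) :
    refl c r z = z := by
  have h0 : z - c ≠ 0 := norm_pos_iff.1 (hz ▸ hr)
  have h1 : conj (z - c) ≠ 0 := (map_ne_zero _).2 h0
  have h : refl c r z - c = z - c := by
    rw [refl_sub_center, div_eq_iff h1, mul_conj, normSq_eq_norm_sq, hz]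
    push_cast
    rfl
  exact sub_left_injective h

/-- Outside its circle, an inversion is `1`-Lipschitz. -/
theorem lipschitzOnWith_refl {c r : ℝ} (hr : 0 < r) :
    LipschitzOnWith 1 (refl c r) (Metric.ball (c : ℂ) r)ᶜ := by
  refine LipschitzOnWith.of_dist_le_mul fun z hz w hw => ?_
  rw [mem_compl_iff, mem_ball_iff_norm, not_lt] at hz hw
  have hz0 : conj (z - c) ≠ 0 := (map_ne_zero _).2 (norm_pos_iff.1 (hr.trans_le hz))
  have hw0 : conj (w - c) ≠ 0 := (map_ne_zero _).2 (norm_pos_iff.1 (hr.trans_le hw))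
  have e : refl c r z - refl c r w
      = r ^ 2 * conj (w - z) / (conj (z - c) * conj (w - c)) := by
    rw [refl, refl, add_sub_add_left_eq_sub, div_sub_div _ _ hz0 hw0]
    congr 1
    simp only [map_sub]
    ring
  rw [dist_eq_norm, dist_eq_norm, e, norm_div, norm_mul, norm_mul, norm_conj, norm_conj, norm_conj,
    norm_pow, norm_real, Real.norm_of_nonneg hr.le, NNReal.coe_one, one_mul, norm_sub_rev w z,
    div_le_iff₀ (mul_pos (hr.trans_le hz) (hr.trans_le hw)), mul_comm, pow_two]
  gcongr

theorem differentiableAt_conj_comp_refl {c r : ℝ} {F : ℂ → ℂ} {z : ℂ} (hz : z ≠ c)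
    (hF : DifferentiableAt ℂ F (refl c r z)) :
    DifferentiableAt ℂ (fun z => conj (F (refl c r z))) z := by
  have hz' : z - c ≠ 0 := sub_ne_zero.2 hz
  have h1 : DifferentiableAt ℂ (fun z : ℂ => (c : ℂ) + r ^ 2 / (z - c)) z := by
    fun_prop (disch := exact hz')
  have hconj : ∀ z : ℂ, conj (refl c r z) = c + r ^ 2 / (z - c) := fun z => by simp [refl]
  have h2 := hF.conj_conj
  rw [hconj] at h2
  have h3 := DifferentiableAt.comp z h2 h1
  refine h3.congr_of_eventuallyEq (Eventually.of_forall fun w => ?_)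
  simp only [Function.comp_apply]
  rw [← hconj, conj_conj]

/-- Two circles `∂B(ci, ri)` and `∂B(ce, re)`, the first inside the second, whose radical axis is
the imaginary axis and which lie in the right half-plane. -/
structure IsCoreShell (ri re ci ce : ℝ) : Prop where
  ri_pos : 0 < ri
  re_pos : 0 < re
  ri_lt : ri < ci
  re_lt : re < ce
  center_lt : ci < ce
  inside : ce - ci + ri < re
  radical : ce ^ 2 - re ^ 2 = ci ^ 2 - ri ^ 2

/-- The common power of the origin with respect to the two circles. -/
def axisPower (ri ci : ℝ) : ℝ := ci ^ 2 - ri ^ 2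

/-- The parameter of the Möbius map that is the composition of the two inversions. -/
noncomputable def reflParam (ri ci ce : ℝ) : ℝ := (ce - ci) / (ci * (ce - ci) + ri ^ 2)

namespace IsCoreShell

variable {ri re ci ce : ℝ} (h : IsCoreShell ri re ci ce)
include h

theorem axisPower_pos : 0 < axisPower ri ci := by
  have := h.ri_pos
  have := h.ri_lt
  rw [axisPower]
  nlinarith

theorem reflParam_pos : 0 < reflParam ri ci ce := by
  have h1 := sub_pos.2 h.center_lt
  have := h.ri_pos
  have := h.ri_pos.trans h.ri_lt
  rw [reflParam]
  positivity

theorem reflParam_sq_mul_le : reflParam ri ci ce ^ 2 * axisPower ri ci ≤ 1 := by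
  have h1 := sub_pos.2 h.center_lt
  have := h.ri_pos
  have := h.ri_pos.trans h.ri_lt
  rw [reflParam, axisPower, div_pow, div_mul_eq_mul_div, div_le_one (by positivity)]
  have : 0 ≤ ri ^ 2 * (2 * ci * (ce - ci) + ri ^ 2 + (ce - ci) ^ 2) := by positivity
  linarith

theorem re_pos_of_mem {z : ℂ} (hz : z ∈ Metric.closedBall (ce : ℂ) re) : 0 < z.re := by
  rw [mem_closedBall_iff_norm] at hz
  have h1 := (abs_re_le_norm (z - ce)).trans hz
  rw [sub_re, ofReal_re] at h1
  have := (abs_le.1 h1).1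
  linarith [h.re_lt]

theorem norm_le_of_mem {z : ℂ} (hz : z ∈ Metric.closedBall (ce : ℂ) re) : ‖z‖ ≤ ce + re := by
  rw [mem_closedBall_iff_norm] at hz
  have h1 := norm_add_le (z - ce) ce
  rw [sub_add_cancel, norm_real, Real.norm_of_nonneg (h.re_pos.trans h.re_lt).le] at h1
  linarith

theorem closedBall_subset : Metric.closedBall (ci : ℂ) ri ⊆ Metric.ball (ce : ℂ) re := by
  refine Metric.closedBall_subset_ball' ?_
  rw [dist_eq_norm, ← ofReal_sub, norm_real, Real.norm_eq_abs, abs_sub_comm,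
    abs_of_pos (sub_pos.2 h.center_lt)]
  linarith [h.inside]

/-- On the outer circle the inversion in the inner circle is a Möbius map. -/
theorem refl_eq_mob {z : ℂ} (hz : ‖z - ce‖ = re) :
    refl ci ri z = mob (axisPower ri ci) (reflParam ri ci ce) z := by
  have h0 : z - ce ≠ 0 := norm_pos_iff.1 (hz ▸ h.re_pos)
  have hmem : z ∈ Metric.closedBall (ce : ℂ) re := by rw [mem_closedBall_iff_norm, hz]
  have hne := one_add_ne_zero h.reflParam_pos.le (h.re_pos_of_mem hmem)
  have h1 := sub_pos.2 h.center_lt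
  have := h.ri_pos
  have := h.ri_pos.trans h.ri_lt
  have hp : (ci * (ce - ci) + ri ^ 2 : ℂ) ≠ 0 := by
    have : 0 < ci * (ce - ci) + ri ^ 2 := by positivity
    exact_mod_cast this.ne'
  have hrad : (ce : ℂ) ^ 2 - re ^ 2 = ci ^ 2 - ri ^ 2 := by exact_mod_cast h.radical
  have hconj : conj (z - ce) * (z - ce) = re ^ 2 := by
    rw [mul_comm, mul_conj, normSq_eq_norm_sq, hz]
    push_cast
    rfl
  have hconj' : conj (z - ci) * (z - ce) = (ce - ci) * z + (ci * (ce - ci) + ri ^ 2) := by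
    have : conj (z - ci) = conj (z - ce) + (ce - ci) := by simp
    rw [this, add_mul, hconj]
    linear_combination -hrad
  have hD : (ci * (ce - ci) + ri ^ 2 : ℂ) * (1 + (reflParam ri ci ce : ℂ) * z)
      = (ce - ci) * z + (ci * (ce - ci) + ri ^ 2) := by
    rw [reflParam]
    push_cast
    field_simp
    ring
  have hN : (ci * (ce - ci) + ri ^ 2 : ℂ) * (z + (reflParam ri ci ce : ℂ) * axisPower ri ci)
      = (ci * (ce - ci) + ri ^ 2) * z + (ce - ci) * (ci ^ 2 - ri ^ 2) := by
    rw [reflParam, axisPower]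
    push_cast
    field_simp
  have hDne : (ce - ci) * z + (ci * (ce - ci) + ri ^ 2) ≠ 0 := hD ▸ mul_ne_zero hp hne
  have hci : conj (z - ci) ≠ 0 := fun h' => hDne (by rw [← hconj', h', zero_mul])
  rw [mob, ← mul_div_mul_left _ _ hp, hD, hN, refl, ← mul_div_mul_right _ _ h0, hconj',
    eq_div_iff hDne, add_mul, div_mul_cancel₀ _ hDne]
  ring

end IsCoreShell

/-! ### The potential -/

/-- The image series attached to the two inversions with reflection coefficients `li`, `le`. -/
noncomputable def shellSeries (ri ci ce li le : ℝ) (f : ℂ → ℂ) : ℂ → ℂ :=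
  imageSeries (axisPower ri ci) (reflParam ri ci ce) (-(le * li)) f

/-- The composition of the two inversions, as a Möbius map. -/
noncomputable def shellMob (ri ci ce : ℝ) : ℂ → ℂ :=
  mob (axisPower ri ci) (reflParam ri ci ce)

open Classical in
/-- The method-of-images solution with background `Re f`, up to an additive constant. -/
noncomputable def potential (ri re ci ce li le : ℝ) (f : ℂ → ℂ) (z : ℂ) : ℝ :=
  if z ∈ Metric.ball (ci : ℂ) ri then
    (1 - li) * (1 - le) * (shellSeries ri ci ce li le f z).re
  else if z ∈ Metric.ball (ce : ℂ) re then
    (1 - le) * ((shellSeries ri ci ce li le f z).re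
      - li * (shellSeries ri ci ce li le f (refl ci ri z)).re)
  else
    (f z).re - le * (shellSeries ri ci ce li le f (refl ce re z)).re
      - li * (shellSeries ri ci ce li le f (shellMob ri ci ce (refl ce re z))).re

/-- The Cauchy-Riemann equations as a relation between gradients. -/
theorem gradient_eq_I_mul_of_conj {u v : ℂ → ℝ} {g : ℂ → ℂ} {z : ℂ} {s : ℝ} (hg : DifferentiableAt ℂ g z)
    (hu : u =ᶠ[𝓝 z] fun z => (g z).re) (hv : v =ᶠ[𝓝 z] fun z => s * (g z).im) :
    gradient v z = I * (s * gradient u z) := by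
  have hg' : HasFDerivAt g ((fderiv ℂ g z).restrictScalars ℝ) z :=
    hg.hasFDerivAt.restrictScalars ℝ
  have hre : HasFDerivAt (fun z => (g z).re) _ z := reCLM.hasFDerivAt.comp z hg'
  have him : HasFDerivAt (fun z => s * (g z).im) _ z :=
    (imCLM.hasFDerivAt.comp z hg').const_mul s
  have hlin : fderiv ℂ g z I = I * fderiv ℂ g z 1 := by
    rw [← smul_eq_mul, ← map_smul, smul_eq_mul, mul_one]
  apply Complex.ext
  · rw [re_gradient, hv.fderiv_eq, him.fderiv]
    simp only [mul_re, mul_im, I_re, I_im, re_gradient, im_gradient, hu.fderiv_eq, hre.fderiv]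
    simp [hlin]
  · rw [im_gradient, hv.fderiv_eq, him.fderiv]
    simp only [mul_re, mul_im, I_re, I_im, re_gradient, im_gradient, hu.fderiv_eq, hre.fderiv]
    simp [hlin]

namespace IsCoreShell

variable {ri re ci ce li le : ℝ} {f : ℂ → ℂ} (h : IsCoreShell ri re ci ce)
include h

theorem shellSeries_eq (hμ : |le * li| < 1) (hf : Differentiable ℂ f) {z : ℂ} (hz : 0 < z.re) :
    shellSeries ri ci ce li le f z
      = f z - le * li * shellSeries ri ci ce li le f (shellMob ri ci ce z) := by
  have := imageSeries_eq (μ := -(le * li)) h.axisPower_pos h.reflParam_pos h.reflParam_sq_mul_le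
    (by rwa [abs_neg]) hf hz
  rw [shellSeries, shellMob, this]
  push_cast
  ring

theorem potential_of_mem_closedBall_core {z : ℂ} (hz : z ∈ Metric.closedBall (ci : ℂ) ri) :
    potential ri re ci ce li le f z
      = (1 - li) * (1 - le) * (shellSeries ri ci ce li le f z).re := by
  rw [potential]
  split_ifs with h1 h2
  · rfl
  · have : ‖z - ci‖ = ri := by
      rw [mem_closedBall_iff_norm] at hz
      rw [mem_ball_iff_norm, not_lt] at h1
      exact le_antisymm hz h1
    rw [refl_of_mem_sphere h.ri_pos this]
    ring
  · exact absurd (h.closedBall_subset hz) h2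

theorem potential_of_notMem_outer {z : ℂ} (hz : z ∉ Metric.ball (ce : ℂ) re) :
    potential ri re ci ce li le f z
      = (f z).re - le * (shellSeries ri ci ce li le f (refl ce re z)).re
        - li * (shellSeries ri ci ce li le f (shellMob ri ci ce (refl ce re z))).re := by
  have h1 : z ∉ Metric.ball (ci : ℂ) ri := fun h' =>
    hz (h.closedBall_subset (Metric.ball_subset_closedBall h'))
  rw [potential, if_neg h1, if_neg hz]

/-- The formula for the shell is valid up to the outer circle, by the functional equation of the
series. -/
theorem potential_of_mem_closedBall_outer (hμ : |le * li| < 1) (hf : Differentiable ℂ f) {z : ℂ}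
    (hz : z ∈ Metric.closedBall (ce : ℂ) re) (hzi : z ∉ Metric.ball (ci : ℂ) ri) :
    potential ri re ci ce li le f z = (1 - le) * ((shellSeries ri ci ce li le f z).re
      - li * (shellSeries ri ci ce li le f (refl ci ri z)).re) := by
  by_cases h2 : z ∈ Metric.ball (ce : ℂ) re
  · rw [potential, if_neg hzi, if_pos h2]
  · have hs : ‖z - ce‖ = re := by
      rw [mem_closedBall_iff_norm] at hz
      rw [mem_ball_iff_norm, not_lt] at h2
      exact le_antisymm hz h2
    have e := congrArg Complex.re (h.shellSeries_eq hμ hf (h.re_pos_of_mem hz))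
    rw [h.potential_of_notMem_outer h2, refl_of_mem_sphere h.re_pos hs, h.refl_eq_mob hs,
      ← shellMob]
    rw [sub_re, ← ofReal_mul, re_ofReal_mul] at e
    linear_combination -e

/-- The correction to the background is globally Lipschitz. The three formulas agree on the circles,
so it suffices to estimate each of them; the factor is largest in the core, where it is
`|1 - li| * |1 - le| + 1 ≤ 5`. -/
theorem lipschitzWith_potential_sub (hli : |li| ≤ 1) (hle : |le| ≤ 1) (hμ : |le * li| < 1)
    (hf : Differentiable ℂ f) {L : ℝ≥0}
    (hfL : LipschitzOnWith L f (Metric.closedBall (ce : ℂ) re))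
    (hS : LipschitzOnWith L (shellSeries ri ci ce li le f) (Metric.closedBall (ce : ℂ) re))
    (hST : LipschitzOnWith L (fun z => shellSeries ri ci ce li le f (shellMob ri ci ce z))
      (Metric.closedBall (ce : ℂ) re)) :
    LipschitzWith (5 * L) fun z => potential ri re ci ce li le f z - (f z).re := by
  have hre : ∀ {F : ℂ → ℂ} {s : Set ℂ} {z w : ℂ}, LipschitzOnWith L F s → z ∈ s → w ∈ s →
      |(F z).re - (F w).re| ≤ L * dist z w := by
    intro F s z w hF hz hw
    rw [← sub_re]
    refine (abs_re_le_norm _).trans ?_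
    rw [← dist_eq_norm]
    exact hF.dist_le_mul z hz w hw
  have hscale : ∀ {c x B : ℝ} (k : ℝ), |c| ≤ k → |x| ≤ B → |c * x| ≤ k * B := by
    intro c x B k hc hx
    rw [abs_mul]
    exact mul_le_mul hc hx (abs_nonneg _) ((abs_nonneg _).trans hc)
  have h1li : |1 - li| ≤ 2 := by
    rw [abs_le] at hli ⊢; constructor <;> linarith
  have h1le : |1 - le| ≤ 2 := by
    rw [abs_le] at hle ⊢; constructor <;> linarith
  have hsub : Metric.closedBall (ci : ℂ) ri ⊆ Metric.closedBall (ce : ℂ) re :=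
    h.closedBall_subset.trans Metric.ball_subset_closedBall
  have hcontr : ∀ {c r : ℝ} (_ : 0 < r) {z w : ℂ}, z ∉ Metric.ball (c : ℂ) r →
      w ∉ Metric.ball (c : ℂ) r → dist (refl c r z) (refl c r w) ≤ dist z w := by
    intro c r hr z w hz hw
    simpa using (lipschitzOnWith_refl hr).dist_le_mul z hz w hw
  have hL : (0 : ℝ) ≤ L := L.2
  have hL5 : ((5 * L : ℝ≥0) : ℝ) = 5 * L := by push_cast; rfl
  have hin : LipschitzOnWith (5 * L) (fun z => potential ri re ci ce li le f z - (f z).re)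
      (Metric.closedBall (ce : ℂ) re) := by
    refine lipschitzOnWith_of_closed_cover (convex_closedBall _ _)
      (A := Metric.closedBall (ci : ℂ) ri) (B := (Metric.ball (ci : ℂ) ri)ᶜ)
      Metric.isClosed_closedBall Metric.isOpen_ball.isClosed_compl (fun z _ => ?_) ?_ ?_
    · by_cases hz : z ∈ Metric.ball (ci : ℂ) ri
      · exact Or.inl (Metric.ball_subset_closedBall hz)
      · exact Or.inr hz
    · refine LipschitzOnWith.of_dist_le_mul fun z hz w hw => ?_
      rw [Real.dist_eq, h.potential_of_mem_closedBall_core hz.2,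
        h.potential_of_mem_closedBall_core hw.2, hL5]
      have a1 := hre hS hz.1 hw.1
      have a2 := hre hfL hz.1 hw.1
      have a3 := hscale 2 h1li (hscale 2 h1le a1)
      rw [abs_le] at a2 a3 ⊢
      constructor <;> linarith
    · refine LipschitzOnWith.of_dist_le_mul fun z hz w hw => ?_
      rw [Real.dist_eq, h.potential_of_mem_closedBall_outer hμ hf hz.1 hz.2,
        h.potential_of_mem_closedBall_outer hμ hf hw.1 hw.2, hL5]
      have a1 := hre hS hz.1 hw.1
      have a2 := hre hfL hz.1 hw.1
      have a3 := hre hS (hsub (refl_mem_closedBall h.ri_pos hz.2))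
        (hsub (refl_mem_closedBall h.ri_pos hw.2))
      have a4 := a3.trans (mul_le_mul_of_nonneg_left (hcontr h.ri_pos hz.2 hw.2) hL)
      have a5 := hscale 2 h1le a1
      have a6 := hscale 2 h1le (hscale 1 hli a4)
      rw [abs_le] at a2 a5 a6 ⊢
      constructor <;> linarith
  rw [← lipschitzOnWith_univ]
  refine lipschitzOnWith_of_closed_cover convex_univ
    (A := Metric.closedBall (ce : ℂ) re) (B := (Metric.ball (ce : ℂ) re)ᶜ)
    Metric.isClosed_closedBall Metric.isOpen_ball.isClosed_compl (fun z _ => ?_) ?_ ?_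
  · by_cases hz : z ∈ Metric.ball (ce : ℂ) re
    · exact Or.inl (Metric.ball_subset_closedBall hz)
    · exact Or.inr hz
  · exact hin.mono inter_subset_right
  · refine LipschitzOnWith.of_dist_le_mul fun z hz w hw => ?_
    rw [Real.dist_eq, h.potential_of_notMem_outer hz.2, h.potential_of_notMem_outer hw.2, hL5]
    have hz' := refl_mem_closedBall h.re_pos hz.2
    have hw' := refl_mem_closedBall h.re_pos hw.2
    have hd := mul_le_mul_of_nonneg_left (hcontr h.re_pos hz.2 hw.2) hL
    have a1 := hscale 1 hle ((hre hS hz' hw').trans hd)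
    have a2 := hscale 1 hli ((hre hST hz' hw').trans hd)
    have a3 : 0 ≤ L * dist z w := by positivity
    rw [abs_le] at a1 a2 ⊢
    constructor <;> linarith

theorem differentiableAt_shellSeries (hμ : |le * li| < 1) (hf : Differentiable ℂ f) {z : ℂ}
    (hz : 0 < z.re) : DifferentiableAt ℂ (shellSeries ri ci ce li le f) z :=
  differentiableAt_imageSeries h.axisPower_pos h.reflParam_pos h.reflParam_sq_mul_le
    (by rwa [abs_neg]) hf hz

theorem differentiableAt_shellSeries_shellMob (hμ : |le * li| < 1) (hf : Differentiable ℂ f)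
    {z : ℂ} (hz : 0 < z.re) :
    DifferentiableAt ℂ (fun z => shellSeries ri ci ce li le f (shellMob ri ci ce z)) z :=
  differentiableAt_imageSeries_mob h.axisPower_pos h.reflParam_pos h.reflParam_sq_mul_le
    (by rwa [abs_neg]) hf hz

/-- Away from the two circles, the potential with opposite reflection coefficients and background
`Im f` is a stream function: its gradient is the flux of the potential with background `Re f`,
rotated by a right angle. -/
theorem gradient_potential_neg {ki ke s : ℝ} (hi : ki * (1 - li) = ke * (1 + li))
    (he : ke * (1 - le) = 1 + le) (hμ : |le * li| < 1) (hf : Differentiable ℂ f) {z : ℂ}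
    (hs : z ∈ Metric.ball (ci : ℂ) ri ∧ s = ki ∨
      z ∈ Metric.ball (ce : ℂ) re ∧ z ∉ Metric.closedBall (ci : ℂ) ri ∧ s = ke ∨
      z ∉ Metric.closedBall (ce : ℂ) re ∧ s = 1) :
    gradient (potential ri re ci ce (-li) (-le) fun z => -I * f z) z
      = I * (s * gradient (potential ri re ci ce li le f) z) := by
  have hser : ∀ w, shellSeries ri ci ce (-li) (-le) (fun z => -I * f z) w
      = -I * shellSeries ri ci ce li le f w := by
    intro w
    rw [shellSeries, shellSeries, neg_mul_neg]
    exact imageSeries_const_mul _ _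
  have hIm : ∀ w : ℂ, (-I * w).re = w.im := fun w => by simp
  have hsub : Metric.closedBall (ci : ℂ) ri ⊆ Metric.closedBall (ce : ℂ) re :=
    h.closedBall_subset.trans Metric.ball_subset_closedBall
  rcases hs with ⟨hz, rfl⟩ | ⟨hz, hzi, rfl⟩ | ⟨hz, rfl⟩
  · have hzP := h.re_pos_of_mem (hsub (Metric.ball_subset_closedBall hz))
    have hnhds := Metric.isOpen_ball.mem_nhds hz
    refine gradient_eq_I_mul_of_conj (g := fun z => ((1 - li) * (1 - le) : ℝ) * shellSeries ri ci ce li le f z)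
      ((h.differentiableAt_shellSeries hμ hf hzP).const_mul _) ?_ ?_
    · filter_upwards [hnhds] with w hw
      rw [h.potential_of_mem_closedBall_core (Metric.ball_subset_closedBall hw), re_ofReal_mul]
    · filter_upwards [hnhds] with w hw
      rw [h.potential_of_mem_closedBall_core (Metric.ball_subset_closedBall hw), im_ofReal_mul,
        hser, hIm]
      linear_combination (-(1 - le) * (shellSeries ri ci ce li le f w).im) * hi
        - (1 + li) * (shellSeries ri ci ce li le f w).im * he
  · have hzP := h.re_pos_of_mem (Metric.ball_subset_closedBall hz)
    have hnhds := (Metric.isOpen_ball.inter Metric.isClosed_closedBall.isOpen_compl).mem_nhds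
      ⟨hz, hzi⟩
    have hout : ∀ w, w ∉ Metric.closedBall (ci : ℂ) ri → w ∉ Metric.ball (ci : ℂ) ri :=
      fun w hw h' => hw (Metric.ball_subset_closedBall h')
    have hne : z ≠ ci := fun h' => hzi (by
      rw [h']; exact Metric.mem_closedBall_self h.ri_pos.le)
    have hrP := h.re_pos_of_mem (hsub (refl_mem_closedBall h.ri_pos (hout z hzi)))
    refine gradient_eq_I_mul_of_conj (g := fun z => ((1 - le : ℝ) : ℂ) * (shellSeries ri ci ce li le f z
      - li * conj (shellSeries ri ci ce li le f (refl ci ri z))))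
      (((h.differentiableAt_shellSeries hμ hf hzP).sub
        ((differentiableAt_conj_comp_refl hne
          (h.differentiableAt_shellSeries hμ hf hrP)).const_mul _)).const_mul _) ?_ ?_
    · filter_upwards [hnhds] with w hw
      rw [h.potential_of_mem_closedBall_outer hμ hf (Metric.ball_subset_closedBall hw.1)
        (hout w hw.2), re_ofReal_mul, sub_re, re_ofReal_mul, conj_re]
    · filter_upwards [hnhds] with w hw
      rw [h.potential_of_mem_closedBall_outer (by rwa [neg_mul_neg]) (hf.const_mul _)
        (Metric.ball_subset_closedBall hw.1) (hout w hw.2), im_ofReal_mul, sub_im, im_ofReal_mul,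
        conj_im, hser, hser, hIm, hIm]
      linear_combination (-((shellSeries ri ci ce li le f w).im
        + li * (shellSeries ri ci ce li le f (refl ci ri w)).im)) * he
  · have hnhds := Metric.isClosed_closedBall.isOpen_compl.mem_nhds hz
    have hout : ∀ w, w ∉ Metric.closedBall (ce : ℂ) re → w ∉ Metric.ball (ce : ℂ) re :=
      fun w hw h' => hw (Metric.ball_subset_closedBall h')
    have hne : z ≠ ce := fun h' => hz (by
      rw [h']; exact Metric.mem_closedBall_self h.re_pos.le)
    have hrP := h.re_pos_of_mem (refl_mem_closedBall h.re_pos (hout z hz))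
    refine gradient_eq_I_mul_of_conj (g := fun z => f z
      - le * conj (shellSeries ri ci ce li le f (refl ce re z))
      - li * conj (shellSeries ri ci ce li le f (shellMob ri ci ce (refl ce re z))))
      (((hf z).sub ((differentiableAt_conj_comp_refl hne
          (h.differentiableAt_shellSeries hμ hf hrP)).const_mul _)).sub
        ((differentiableAt_conj_comp_refl hne
          (h.differentiableAt_shellSeries_shellMob hμ hf hrP)).const_mul _)) ?_ ?_
    · filter_upwards [hnhds] with w hw
      rw [h.potential_of_notMem_outer (hout w hw), sub_re, sub_re, re_ofReal_mul, re_ofReal_mul,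
        conj_re, conj_re]
    · filter_upwards [hnhds] with w hw
      rw [h.potential_of_notMem_outer (hout w hw), sub_im, sub_im, im_ofReal_mul, im_ofReal_mul,
        conj_im, conj_im, hser, hser, hIm, hIm, hIm]
      ring

end IsCoreShell

/-! ### Existence -/

theorem isCoreShell_centers {ri re ε : ℝ} (hri : 0 < ri) (hre : ri < re) (hε : 0 < ε)
    (hε' : ε < re - ri) :
    IsCoreShell ri re (coreCenter ri re ε) (shellCenter ri re ε) := by
  obtain ⟨d, hd⟩ : ∃ d, d = re - ri - ε := ⟨_, rfl⟩
  have hd0 : 0 < d := by linarith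
  have hci : coreCenter ri re ε = (re ^ 2 - ri ^ 2 - d ^ 2) / (2 * d) := by rw [coreCenter, hd]
  have hce : shellCenter ri re ε = (re ^ 2 - ri ^ 2 + d ^ 2) / (2 * d) := by
    rw [shellCenter, show coreCenter ri re ε + re - ri - ε = coreCenter ri re ε + d by
      rw [hd]; ring, hci]
    field_simp
    ring
  rw [hci, hce]
  have h1 : (re ^ 2 - ri ^ 2 + d ^ 2) / (2 * d) - (re ^ 2 - ri ^ 2 - d ^ 2) / (2 * d) = d := by
    field_simp
    ring
  refine ⟨hri, by linarith, ?_, ?_, by linarith, by linarith, ?_⟩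
  · rw [lt_div_iff₀ (by positivity)]
    nlinarith
  · rw [lt_div_iff₀ (by positivity)]
    nlinarith
  · field_simp
    ring

section conductivity

variable {ri re ε ki ke : ℝ}

theorem conductivity_of_mem_core {x : ℂ} (hx : x ∈ core ri re ε) (hx' : x ∈ outerDisk ri re ε) :
    conductivity ri re ε ki ke x = ki := by
  simp [conductivity, hx, hx']

theorem conductivity_of_mem_shell {x : ℂ} (hx : x ∉ core ri re ε) (hx' : x ∈ outerDisk ri re ε) :
    conductivity ri re ε ki ke x = ke := by
  simp [conductivity, hx, hx']

theorem conductivity_of_notMem {x : ℂ} (hx : x ∉ core ri re ε) (hx' : x ∉ outerDisk ri re ε) :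
    conductivity ri re ε ki ke x = 1 := by
  simp [conductivity, hx, hx']

theorem measurable_conductivity : Measurable (conductivity ri re ε ki ke) := by
  have h1 : MeasurableSet (core ri re ε) := measurableSet_ball
  have h2 : MeasurableSet (outerDisk ri re ε) := measurableSet_ball
  exact ((measurable_const.indicator h1).add (measurable_const.indicator (h2.diff h1))).add
    (measurable_const.indicator h2.compl)

theorem conductivity_pos (hki : 0 < ki) (hke : 0 < ke) (x : ℂ) :
    0 < conductivity ri re ε ki ke x := by
  by_cases h1 : x ∈ core ri re ε <;> by_cases h2 : x ∈ outerDisk ri re ε <;>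
    simp [conductivity, h1, h2] <;> positivity

theorem conductivity_le (hki : 0 < ki) (hke : 0 < ke) (x : ℂ) :
    conductivity ri re ε ki ke x ≤ ki + ke + 1 := by
  by_cases h1 : x ∈ core ri re ε <;> by_cases h2 : x ∈ outerDisk ri re ε <;>
    simp [conductivity, h1, h2] <;> linarith

end conductivity

namespace IsCoreShell

variable {ri re ci ce li le : ℝ} {f : ℂ → ℂ} (h : IsCoreShell ri re ci ce)
include h

theorem exists_lipschitzOnWith (hμ : |le * li| < 1) (hf : Differentiable ℂ f) :
    ∃ L : ℝ≥0, LipschitzOnWith L f (Metric.closedBall (ce : ℂ) re) ∧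
      LipschitzOnWith L (shellSeries ri ci ce li le f) (Metric.closedBall (ce : ℂ) re) ∧
      LipschitzOnWith L (fun z => shellSeries ri ci ce li le f (shellMob ri ci ce z))
        (Metric.closedBall (ce : ℂ) re) := by
  have key : ∀ {F : ℂ → ℂ}, (∀ z : ℂ, 0 < z.re → DifferentiableAt ℂ F z) →
      ∃ K : ℝ≥0, LipschitzOnWith K F (Metric.closedBall (ce : ℂ) re) := fun hF =>
    exists_lipschitzOnWith_of_differentiableAt isOpen_re_pos hF (fun z hz => h.re_pos_of_mem hz)
      (convex_closedBall _ _) (isCompact_closedBall _ _)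
  obtain ⟨K₁, h₁⟩ := key fun z _ => hf z
  obtain ⟨K₂, h₂⟩ := key fun z hz => h.differentiableAt_shellSeries (li := li) (le := le) hμ hf hz
  obtain ⟨K₃, h₃⟩ := key fun z hz =>
    h.differentiableAt_shellSeries_shellMob (li := li) (le := le) hμ hf hz
  exact ⟨max K₁ (max K₂ K₃), h₁.weaken (le_max_left _ _),
    h₂.weaken ((le_max_left _ _).trans (le_max_right _ _)),
    h₃.weaken ((le_max_right _ _).trans (le_max_right _ _))⟩

/-- At infinity the potential minus the background tends to a constant at rate `|z|⁻¹`. -/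
theorem potential_decay {L : ℝ≥0}
    (hS : LipschitzOnWith L (shellSeries ri ci ce li le f) (Metric.closedBall (ce : ℂ) re))
    (hST : LipschitzOnWith L (fun z => shellSeries ri ci ce li le f (shellMob ri ci ce z))
      (Metric.closedBall (ce : ℂ) re)) :
    (fun z => potential ri re ci ce li le f z + (le * (shellSeries ri ci ce li le f ce).re
      + li * (shellSeries ri ci ce li le f (shellMob ri ci ce ce)).re) - (f z).re)
      =O[Bornology.cobounded ℂ] fun z => ‖z‖⁻¹ := by
  have hce := h.re_pos.trans h.re_lt
  refine IsBigO.of_bound ((|le| + |li|) * (L * (2 * re ^ 2))) ?_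
  have hev : ∀ᶠ z in Bornology.cobounded ℂ, 2 * ce + re ≤ ‖z‖ :=
    tendsto_norm_cobounded_atTop.eventually_ge_atTop _
  filter_upwards [hev] with z hz
  have hzr : ‖z‖ ≤ ‖z - ce‖ + ce := by
    have h1 := norm_add_le (z - ce) ce
    rwa [sub_add_cancel, norm_real, Real.norm_of_nonneg hce.le] at h1
  have hre := h.re_pos
  have hz0 : 0 < ‖z‖ := by linarith
  have hzc : 0 < ‖z - ce‖ := by linarith
  have hzm : z ∉ Metric.ball (ce : ℂ) re := by
    rw [mem_ball_iff_norm, not_lt]; linarith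
  have hmem := refl_mem_closedBall h.re_pos hzm
  have hcm : (ce : ℂ) ∈ Metric.closedBall (ce : ℂ) re := Metric.mem_closedBall_self h.re_pos.le
  have hd : dist (refl ce re z) ce ≤ 2 * re ^ 2 * ‖z‖⁻¹ := by
    rw [dist_eq_norm, norm_refl_sub_center, ← div_eq_mul_inv, div_le_div_iff₀ hzc hz0]
    nlinarith [sq_nonneg re]
  have hdiff : ∀ {F : ℂ → ℂ}, LipschitzOnWith L F (Metric.closedBall (ce : ℂ) re) →
      |(F (refl ce re z)).re - (F ce).re| ≤ L * (2 * re ^ 2 * ‖z‖⁻¹) := by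
    intro F hF
    rw [← sub_re]
    refine (abs_re_le_norm _).trans ?_
    rw [← dist_eq_norm]
    exact (hF.dist_le_mul _ hmem _ hcm).trans (mul_le_mul_of_nonneg_left hd L.2)
  rw [h.potential_of_notMem_outer hzm, Real.norm_eq_abs, norm_inv, norm_norm]
  set S := shellSeries ri ci ce li le f with hSdef
  have e : (f z).re - le * (S (refl ce re z)).re - li * (S (shellMob ri ci ce (refl ce re z))).re
      + (le * (S ce).re + li * (S (shellMob ri ci ce ce)).re) - (f z).re
      = -(le * ((S (refl ce re z)).re - (S ce).re)
        + li * ((S (shellMob ri ci ce (refl ce re z))).re - (S (shellMob ri ci ce ce)).re)) := by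
    ring
  rw [e, abs_neg]
  refine (abs_add_le _ _).trans ?_
  rw [abs_mul, abs_mul]
  have b1 := mul_le_mul_of_nonneg_left (hdiff hS) (abs_nonneg le)
  have b2 := mul_le_mul_of_nonneg_left (hdiff hST) (abs_nonneg li)
  linarith

end IsCoreShell

theorem LipschitzOnDisks.congr {f g : ℂ → ℝ} (hf : LipschitzOnDisks f) (hfg : ∀ x, f x = g x) :
    LipschitzOnDisks g := (funext hfg : f = g) ▸ hf

/-- Existence of solutions for all backgrounds, with a Lipschitz bound for the correction to the
background in terms of the image series with the reflection coefficients `li`, `le`. -/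
theorem exists_isSolution {ri re ε ki ke : ℝ}
    (h : IsCoreShell ri re (coreCenter ri re ε) (shellCenter ri re ε)) (hki : 0 < ki) (hke : 0 < ke)
    {f : ℂ → ℂ} (hf : Differentiable ℂ f) :
    ∃ li le : ℝ, |le * li| < 1 ∧ ∃ u : ℂ → ℝ,
      IsSolution (conductivity ri re ε ki ke) (fun z => (f z).re) u ∧
      ∀ L : ℝ≥0, LipschitzOnWith L f (Metric.closedBall (shellCenter ri re ε : ℂ) re) →
        LipschitzOnWith L (shellSeries ri (coreCenter ri re ε) (shellCenter ri re ε) li le f)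
          (Metric.closedBall (shellCenter ri re ε : ℂ) re) →
        LipschitzOnWith L (fun z => shellSeries ri (coreCenter ri re ε) (shellCenter ri re ε) li le
          f (shellMob ri (coreCenter ri re ε) (shellCenter ri re ε) z))
          (Metric.closedBall (shellCenter ri re ε : ℂ) re) →
        LipschitzWith (5 * L) fun z => u z - (f z).re := by
  obtain ⟨ci, hci⟩ : ∃ ci, ci = coreCenter ri re ε := ⟨_, rfl⟩
  obtain ⟨ce, hce⟩ : ∃ ce, ce = shellCenter ri re ε := ⟨_, rfl⟩
  have hcore : core ri re ε = Metric.ball (ci : ℂ) ri := by rw [core, hci]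
  have houter : outerDisk ri re ε = Metric.ball (ce : ℂ) re := by rw [outerDisk, hce]
  rw [← hci, ← hce] at h
  rw [← hci, ← hce]
  obtain ⟨li, hli⟩ : ∃ li, li = (ki - ke) / (ki + ke) := ⟨_, rfl⟩
  obtain ⟨le, hle⟩ : ∃ le, le = (ke - 1) / (ke + 1) := ⟨_, rfl⟩
  have hli1 : |li| < 1 := by
    rw [hli, abs_div, abs_of_pos (a := ki + ke) (by positivity), div_lt_one (by positivity), abs_lt]
    constructor <;> linarith
  have hle1 : |le| < 1 := by
    rw [hle, abs_div, abs_of_pos (a := ke + 1) (by positivity), div_lt_one (by positivity), abs_lt]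
    constructor <;> linarith
  have hμ : |le * li| < 1 := by
    rw [abs_mul]
    exact mul_lt_one_of_nonneg_of_lt_one_left (abs_nonneg _) hle1 hli1.le
  have hi : ki * (1 - li) = ke * (1 + li) := by
    have : ki + ke ≠ 0 := by positivity
    rw [hli]
    field_simp
    ring
  have he : ke * (1 - le) = 1 + le := by
    have : ke + 1 ≠ 0 := by positivity
    rw [hle]
    field_simp
    ring
  obtain ⟨κ, hκ⟩ : ∃ κ, κ = le * (shellSeries ri ci ce li le f ce).re
      + li * (shellSeries ri ci ce li le f (shellMob ri ci ce ce)).re := ⟨_, rfl⟩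
  have hlip : ∀ {li le : ℝ}, |li| < 1 → |le| < 1 → |le * li| < 1 → ∀ {g : ℂ → ℂ},
      Differentiable ℂ g → LipschitzOnDisks (potential ri re ci ce li le g) := by
    intro li le h1 h2 h3 g hg
    obtain ⟨L, a1, a2, a3⟩ := h.exists_lipschitzOnWith (li := li) (le := le) h3 hg
    exact ((h.lipschitzWith_potential_sub h1.le h2.le h3 hg a1 a2 a3).lipschitzOnDisks.add
      (lipschitzOnDisks_re hg)).congr fun x => by ring
  have hpot := hlip hli1 hle1 hμ hf
  have hstream := hlip (li := -li) (le := -le) (by rwa [abs_neg]) (by rwa [abs_neg])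
    (by rwa [neg_mul_neg]) (hf.const_mul (-I))
  have hconst : LipschitzOnDisks fun _ : ℂ => κ := fun _ => ⟨0, (LipschitzWith.const κ).lipschitzOnWith⟩
  have hu : LipschitzOnDisks fun z => potential ri re ci ce li le f z + κ := hpot.add hconst
  have hgrad : gradient (fun z => potential ri re ci ce li le f z + κ)
      = gradient (potential ri re ci ce li le f) := by
    ext1 x
    rw [gradient, gradient, fderiv_add_const]
  refine ⟨li, le, hμ, fun z => potential ri re ci ce li le f z + κ, ⟨hu.continuous,
    ⟨_, hu.hasWeakGradient, fun K hK => hu.memLp_gradient hK 2, fun φ hφ hφc => ?_⟩, ?_⟩, ?_⟩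
  · rw [hgrad]
    refine Eq.trans (integral_congr_ae ?_) (hstream.hasWeakGradient.integral_inner_I_mul hφ hφc)
    have n1 : ∀ᵐ x : ℂ ∂volume, x ∉ Metric.sphere (ci : ℂ) ri :=
      measure_eq_zero_iff_ae_notMem.1 (Measure.addHaar_sphere volume _ _)
    have n2 : ∀ᵐ x : ℂ ∂volume, x ∉ Metric.sphere (ce : ℂ) re :=
      measure_eq_zero_iff_ae_notMem.1 (Measure.addHaar_sphere volume _ _)
    -- off the circles, which are null sets, the stream function has the rotated flux as gradient
    filter_upwards [n1, n2] with x hx1 hx2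
    have hσ : x ∈ Metric.ball (ci : ℂ) ri ∧ conductivity ri re ε ki ke x = ki ∨
        x ∈ Metric.ball (ce : ℂ) re ∧ x ∉ Metric.closedBall (ci : ℂ) ri ∧
          conductivity ri re ε ki ke x = ke ∨
        x ∉ Metric.closedBall (ce : ℂ) re ∧ conductivity ri re ε ki ke x = 1 := by
      by_cases c1 : x ∈ Metric.ball (ci : ℂ) ri
      · refine Or.inl ⟨c1, conductivity_of_mem_core (by rwa [hcore]) ?_⟩
        rw [houter]
        exact h.closedBall_subset (Metric.ball_subset_closedBall c1)
      · by_cases c2 : x ∈ Metric.ball (ce : ℂ) re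
        · refine Or.inr (Or.inl ⟨c2, ?_, conductivity_of_mem_shell (by rwa [hcore])
            (by rwa [houter])⟩)
          rw [← Metric.ball_union_sphere]
          exact fun h' => h'.elim c1 hx1
        · refine Or.inr (Or.inr ⟨?_, conductivity_of_notMem (by rwa [hcore]) (by rwa [houter])⟩)
          rw [← Metric.ball_union_sphere]
          exact fun h' => h'.elim c2 hx2
    rw [h.gradient_potential_neg hi he hμ hf hσ, Complex.inner, Complex.inner]
    simp
    ring
  · obtain ⟨L, _, a2, a3⟩ := h.exists_lipschitzOnWith (li := li) (le := le) hμ hf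
    rw [hκ]
    exact h.potential_decay a2 a3
  · intro L a1 a2 a3
    have := h.lipschitzWith_potential_sub hli1.le hle1.le hμ hf a1 a2 a3
    refine LipschitzWith.of_dist_le_mul fun x y => ?_
    refine le_trans (le_of_eq ?_) (this.dist_le_mul x y)
    rw [Real.dist_eq, Real.dist_eq]
    congr 1
    ring

/-! ### The uniform bound -/

theorem _root_.LipschitzWith.eLpNorm_gradient_le {w : ℂ → ℝ} {K : ℝ≥0} (hw : LipschitzWith K w) :
    eLpNorm (gradient w) ⊤ volume ≤ K := by
  rw [eLpNorm_exponent_top]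
  refine (eLpNormEssSup_le_of_ae_bound (C := K) (Eventually.of_forall fun x => ?_)).trans
    (by simp)
  exact norm_gradient_le hw.lipschitzOnWith univ_mem

/-- Uniform Lipschitz bound for the background and both image series, when the background has a
critical point at the origin. -/
theorem exists_uniform_lipschitz {ri re ε₀ : ℝ} (hri : 0 < ri) (hre : ri < re)
    (hε₀ : ε₀ < re - ri) {f : ℂ → ℂ} (hf : Differentiable ℂ f) (hf0 : deriv f 0 = 0) :
    ∃ L : ℝ≥0, ∀ ε : ℝ, 0 < ε → ε ≤ ε₀ → ∀ li le : ℝ, |le * li| < 1 →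
      LipschitzOnWith L f (Metric.closedBall (shellCenter ri re ε : ℂ) re) ∧
      LipschitzOnWith L (shellSeries ri (coreCenter ri re ε) (shellCenter ri re ε) li le f)
        (Metric.closedBall (shellCenter ri re ε : ℂ) re) ∧
      LipschitzOnWith L (fun z => shellSeries ri (coreCenter ri re ε) (shellCenter ri re ε) li le
        f (shellMob ri (coreCenter ri re ε) (shellCenter ri re ε) z))
        (Metric.closedBall (shellCenter ri re ε : ℂ) re) := by
  have hre0 : 0 < re := hri.trans hre
  obtain ⟨d₀, hd₀⟩ : ∃ d₀, d₀ = re - ri - ε₀ := ⟨_, rfl⟩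
  have hd₀0 : 0 < d₀ := by linarith
  -- `A` bounds the centre of the outer disk and `√a`
  obtain ⟨A, hA⟩ : ∃ A, A = re ^ 2 / d₀ := ⟨_, rfl⟩
  have hA0 : 0 < A := by rw [hA]; positivity
  have hderiv : Differentiable ℂ (deriv f) :=
    ((hf.contDiff (n := 2)).differentiable_deriv_two)
  obtain ⟨M, hM⟩ := exists_lipschitzOnWith_of_differentiableAt isOpen_univ
    (fun z _ => hderiv z) (subset_univ _) (convex_closedBall (0 : ℂ) (A + re + A))
    (isCompact_closedBall _ _)
  have hM' : ∀ w : ℂ, ‖w‖ ≤ A + re + A → ‖deriv f w‖ ≤ M * ‖w‖ := by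
    intro w hw
    have := hM.dist_le_mul w (mem_closedBall_zero_iff.2 hw) 0
      (Metric.mem_closedBall_self (by positivity))
    simpa [hf0, dist_eq_norm] using this
  refine ⟨(M * (5 * A + 4 * (A + re))).toNNReal, fun ε hε hεle li le hμ => ?_⟩
  have h := isCoreShell_centers hri hre hε (hεle.trans_lt hε₀)
  have hd : shellCenter ri re ε - coreCenter ri re ε = re - ri - ε := by rw [shellCenter]; ring
  have hdd : d₀ ≤ re - ri - ε := by linarith
  have hci : coreCenter ri re ε * (re - ri - ε) = (re ^ 2 - ri ^ 2 - (re - ri - ε) ^ 2) / 2 := by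
    have : re - ri - ε ≠ 0 := by linarith
    rw [coreCenter]
    field_simp
  set ci := coreCenter ri re ε
  set ce := shellCenter ri re ε
  set d := re - ri - ε
  have hd0 : 0 < d := hd₀0.trans_le hdd
  have hceA : ce ≤ A := by
    rw [hA, le_div_iff₀ hd₀0]
    have h1 : ce * d₀ ≤ ce * d :=
      mul_le_mul_of_nonneg_left hdd (h.re_pos.trans h.re_lt).le
    have h2 : ce * d = ci * d + d ^ 2 := by rw [← hd]; ring
    have h3 : d ≤ re := by simp only [d]; linarith
    have h4 : d ^ 2 ≤ re ^ 2 := by gcongr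
    nlinarith
  have hsqrt : √(axisPower ri ci) ≤ A := by
    refine (Real.sqrt_le_sqrt (y := ce ^ 2) ?_).trans ?_
    · rw [axisPower, ← h.radical]
      nlinarith
    · rwa [Real.sqrt_sq (h.re_pos.trans h.re_lt).le]
  have hp0 : 0 < ci * d + ri ^ 2 := by
    have := hri.trans h.ri_lt
    positivity
  have hβ : 5 / reflParam ri ci ce ≤ 5 * A := by
    rw [reflParam, hd, hA, div_div_eq_mul_div, ← mul_div_assoc, div_le_div_iff₀ hd0 hd₀0]
    have h1 : ci * d + ri ^ 2 ≤ re ^ 2 := by nlinarith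
    have := mul_le_mul h1 hdd hd₀0.le (by positivity)
    linarith
  have hconv := convex_closedBall (ce : ℂ) re
  have hP : ∀ z ∈ Metric.closedBall (ce : ℂ) re, 0 < z.re := fun z hz => h.re_pos_of_mem hz
  have hR : ∀ z ∈ Metric.closedBall (ce : ℂ) re, ‖z‖ ≤ A + re := fun z hz =>
    (h.norm_le_of_mem hz).trans (by linarith)
  have hle : (M * (5 / reflParam ri ci ce + 4 * (A + re))).toNNReal
      ≤ (M * (5 * A + 4 * (A + re))).toNNReal := by
    gcongr
  have hM'' : ∀ w : ℂ, ‖w‖ ≤ A + re + √(axisPower ri ci) → ‖deriv f w‖ ≤ M * ‖w‖ :=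
    fun w hw => hM' w (hw.trans (by linarith))
  refine ⟨?_, ?_, ?_⟩
  · refine Convex.lipschitzOnWith_of_nnnorm_deriv_le (fun z _ => hf z) (fun z hz => ?_) hconv
    rw [← NNReal.coe_le_coe, coe_nnnorm]
    refine le_trans ?_ (Real.le_coe_toNNReal _)
    have h1 := hR z hz
    refine (hM' z (by linarith)).trans ?_
    gcongr
    linarith
  · exact (lipschitzOnWith_imageSeries h.axisPower_pos h.reflParam_pos h.reflParam_sq_mul_le
      (by rwa [abs_neg]) hf M.2 hconv hP hR hM'').weaken hle
  · exact (lipschitzOnWith_imageSeries_mob h.axisPower_pos h.reflParam_pos h.reflParam_sq_mul_le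
      (by rwa [abs_neg]) hf M.2 hconv hP hR hM'').weaken hle

theorem linearPart_re {f : ℂ → ℂ} (hf : Differentiable ℂ f) (x : ℂ) :
    linearPart (fun z => (f z).re) x = (deriv f 0 * x).re := by
  have hf' : HasFDerivAt f ((fderiv ℂ f 0).restrictScalars ℝ) 0 :=
    (hf 0).hasFDerivAt.restrictScalars ℝ
  have hre : HasFDerivAt (fun z => (f z).re) _ 0 := reCLM.hasFDerivAt.comp 0 hf'
  rw [linearPart, inner_gradient_left, hre.fderiv]
  simp [mul_comm]

end CoreShell

theorem theorem3p1 (ri re ε₀ : ℝ) (hri : 0 < ri) (hre : ri < re) (hε₀ : ε₀ < re - ri)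
    (H : ℂ → ℝ) (hH : InnerProductSpace.HarmonicOnNhd H Set.univ) :
    ∃ C : ℝ, ∀ ε ki ke : ℝ, 0 < ε → ε ≤ ε₀ → 0 < ki → 0 < ke →
      ∃ u u₁ u₂ : ℂ → ℝ,
        -- `u`, `u₁`, `u₂` are the unique solutions with background `H`, `H₁`, `H₂`
        (∀ v, CoreShell.IsSolution (CoreShell.conductivity ri re ε ki ke) H v ↔ v = u) ∧
        (∀ v, CoreShell.IsSolution (CoreShell.conductivity ri re ε ki ke)
          (CoreShell.linearPart H) v ↔ v = u₁) ∧
        (∀ v, CoreShell.IsSolution (CoreShell.conductivity ri re ε ki ke)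
          (CoreShell.nonlinearPart H) v ↔ v = u₂) ∧
        (∀ x, u x = u₁ x + u₂ x) ∧
        ∃ G : ℂ → ℂ,
          CoreShell.HasWeakGradient (fun x => u₂ x - CoreShell.nonlinearPart H x) G ∧
          MeasureTheory.eLpNorm G ⊤ MeasureTheory.volume < ENNReal.ofReal C := by
  open CoreShell in
  obtain ⟨f, hfa, rfl⟩ := hH.exists_analyticOnNhd_univ_re_eq
  have hf : Differentiable ℂ f := fun z => (hfa z (mem_univ z)).differentiableAt
  -- the nonlinear part is the real part of `f₂`, which has a critical point at the origin
  obtain ⟨f₂, hf₂def⟩ : ∃ f₂ : ℂ → ℂ, f₂ = fun z => f z - deriv f 0 * z := ⟨_, rfl⟩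
  have hf₂ : Differentiable ℂ f₂ := by
    rw [hf₂def]
    exact hf.sub (differentiable_id.const_mul _)
  have hf₂0 : deriv f₂ 0 = 0 := by
    have h1 : HasDerivAt f₂ (deriv f 0 - deriv f 0 * 1) 0 := by
      rw [hf₂def]
      exact (hf 0).hasDerivAt.sub ((hasDerivAt_id (0 : ℂ)).const_mul _)
    rw [h1.deriv]
    ring
  have hnl : nonlinearPart (fun z => (f z).re) = fun z => (f₂ z).re := by
    ext z
    rw [nonlinearPart, linearPart_re hf, hf₂def]
    simp
  obtain ⟨L, hL⟩ := exists_uniform_lipschitz hri hre hε₀ hf₂ hf₂0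
  refine ⟨5 * L + 1, fun ε ki ke hε hεle hki hke => ?_⟩
  have h := isCoreShell_centers hri hre hε (hεle.trans_lt hε₀)
  have hσ : Measurable (conductivity ri re ε ki ke) := measurable_conductivity
  have hσ0 := fun x => conductivity_pos (ri := ri) (re := re) (ε := ε) hki hke x
  have hσm := fun x => conductivity_le (ri := ri) (re := re) (ε := ε) hki hke x
  obtain ⟨-, -, -, u, hu, -⟩ := exists_isSolution h hki hke hf
  obtain ⟨li, le, hμ, u₂, hu₂, hlip⟩ := exists_isSolution h hki hke hf₂
  rw [← hnl] at hu₂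
  have hu₁ := IsSolution.sub hσ (fun x => (abs_of_pos (hσ0 x)).trans_le (hσm x)) hu hu₂
  have hlin : (fun z => (f z).re - nonlinearPart (fun z => (f z).re) z)
      = linearPart fun z => (f z).re := by
    ext z
    rw [nonlinearPart, sub_sub_cancel]
  rw [hlin] at hu₁
  have huniq : ∀ {F w : ℂ → ℝ}, IsSolution (conductivity ri re ε ki ke) F w →
      ∀ v, IsSolution (conductivity ri re ε ki ke) F v ↔ v = w := fun hw v =>
    ⟨fun hv => IsSolution.unique hσ hσ0 hσm hv hw, fun hv => hv ▸ hw⟩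
  refine ⟨u, fun z => u z - u₂ z, u₂, huniq hu, huniq hu₁, huniq hu₂,
    fun x => (sub_add_cancel _ _).symm, ?_⟩
  obtain ⟨b₁, b₂, b₃⟩ := hL ε hε hεle li le hμ
  have hw := hlip L b₁ b₂ b₃
  rw [hnl]
  refine ⟨_, hw.lipschitzOnDisks.hasWeakGradient, hw.eLpNorm_gradient_le.trans_lt ?_⟩
  rw [← ENNReal.ofReal_coe_nnreal, ENNReal.ofReal_lt_ofReal_iff (by positivity)]
  push_cast
  linarith
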